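/- Let $k$ be a field, $R=k[x_1,\dots,x_n]$ with the standard grading, and for a monomial ideal $I\subseteq R$ let $G(I)$ be its minimal set of monomial generators. The linear strand of $I$ is the linear strand of the minimal graded free resolution $F_\bullet$ of $I$: if $F_0$ has initial degree $d$, it is the subcomplex $F^{\mathrm{lin}}_\bullet$ in which $F^{\mathrm{lin}}_i$ is the free submodule of $F_i$ on the basis elements of degree $d+i$. Let $\mathcal P$ be a finite regular CW complex, given by its face poset (with the empty face $\varnothing$ adjoined), i.e. by a finite poset with least element $\varnothing$ and at least one other element in which every open interval $(\varnothing,P)$, $P\ne\varnothing$, is homeomorphic to a sphere (possibly $S^{-1}=\emptyset$). Suppose that each vertex $v$ of $\mathcal P$ is labelled by a monomial $m_v$. The multidegree of a face $P$ is $m_P=\operatorname{lcm}(m_v : v\in V(P))$, where $V(P)$ is the set of vertices of $P$. For an incidence function $\epsilon$ on $\mathcal P$ the cellular complex has as its $i$-th term the free module on basis elements $e_P$ of degree $\deg m_P$, where $P$ runs over the $i$-dimensional faces, with differential $e_P\mapsto\sum_Q\epsilon(P,Q)\,\frac{m_P}{m_Q}\,e_Q$ (the sum over the codimension-one faces $Q$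 of $P$) and augmentation $e_v\mapsto m_v$. The labelled complex $\mathcal P$ supports the linear strand (respectively, a minimal free resolution) of a monomial ideal if, for some incidence function, the cellular complex is isomorphic, as an augmented complex of graded modules, to the linear strand of that ideal (respectively, is a minimal graded free resolution of it). **Theorem.** Let $I\subseteq R$ be a monomial ideal whose linear strand is supported on the labelled regular CW complex $\mathcal P$, and assume that distinct $1$-dimensional faces of $\mathcal P$ have distinct multidegrees. Let $J$ be a monomial ideal with $G(J)\subseteq G(I)$ that contains a generator of $I$ of the least degree occurring in $G(I)$ (if $I$ is generated in a single degree, this only says $J\neq 0$). Let $\mathcal P_J=\{P\in\mathcal P : m_v\in G(J)\text{ for all } v\in V(P)\}$ be the subcomplex induced on the vertices corresponding to generators of $J$. Then $\mathcal P_J$, with the restricted labels, is a regular CW complex that supports the linear strand of $J$. In particular, if $J$ has a linear minimal free resolution, then $\mathcal P_J$ supports a minimal free resolution of $J$, so $J$ has a CW minimal free resolution. -/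

import Mathlib

universe u v w w'

noncomputable section

/-! # Regular CW complexes through their face posets -/

/-- The geometric realization of the order complex (the simplicial complex of chains) of a finite
poset `Q`: the points are the convex combinations of elements of `Q` whose support is a chain. -/
def OrderComplexRealization (Q : Type u) [PartialOrder Q] : Type u :=
  {c : Q → ℝ // (∀ q, 0 ≤ c q) ∧ ∑ᶠ q, c q = 1 ∧ IsChain (· ≤ ·) {q | c q ≠ 0}}

instance (Q : Type u) [PartialOrder Q] : TopologicalSpace (OrderComplexRealization Q) :=
  instTopologicalSpaceSubtype

/-- Björner's CW posets: the posets of faces of regular CW complexes, with the empty face `⊥`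
adjoined. There is at least one nonempty face, and every open interval `(⊥, x)` with `x ≠ ⊥` is
homeomorphic to a sphere `S^(n-1)`, `0 ≤ n`, where `S^(-1)` is empty. (Only finite posets are
used.) -/
def IsCWPoset (P : Type u) [PartialOrder P] [OrderBot P] : Prop :=
  Nontrivial P ∧ ∀ x : P, x ≠ ⊥ →
    ∃ n : ℕ, Nonempty (OrderComplexRealization (Set.Ioo (⊥ : P) x) ≃ₜ
      Metric.sphere (0 : EuclideanSpace ℝ (Fin n)) 1)

/-- The vertices (`0`-dimensional faces) of the complex with face poset `P`. -/
abbrev Vertex (P : Type u) [PartialOrder P] [OrderBot P] : Type u := {v : P // IsAtom v}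

/-- The `i`-dimensional faces of the complex with face poset `P`. -/
abbrev Cell (P : Type u) [PartialOrder P] (i : ℕ) : Type u :=
  {x : P // Order.height x = (i : ℕ∞) + 1}

/-- An incidence function on a regular CW complex with face poset `P`: it takes the values
`0, 1, -1`, it is nonzero exactly on the pairs of a face and a codimension-one face of it, it is
`1` on a vertex and the empty face, and the signs cancel over the faces between two given faces. -/
structure IsIncidenceFunction {P : Type u} [PartialOrder P] [OrderBot P]
    (ε : P → P → ℤ) : Prop where
  values : ∀ x y, ε x y = 0 ∨ ε x y = 1 ∨ ε x y = -1
  ne_zero_iff : ∀ x y, ε x y ≠ 0 ↔ y ⋖ x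
  vertex : ∀ v : Vertex P, ε v.1 ⊥ = 1
  cancel : ∀ x z, ∑ᶠ y, ε x y * ε y z = 0

/-- The face poset of the subcomplex induced on a set `X` of vertices: the faces all of whose
vertices lie in `X`. -/
def InducedSubcomplex {P : Type u} [PartialOrder P] [OrderBot P] (X : Set (Vertex P)) : Type u :=
  {x : P // ∀ v : Vertex P, v.1 ≤ x → v ∈ X}

section Induced

variable {P : Type u} [PartialOrder P] [OrderBot P] (X : Set (Vertex P))

instance : PartialOrder (InducedSubcomplex X) :=
  Subtype.partialOrder _

instance : OrderBot (InducedSubcomplex X) where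
  bot := ⟨⊥, fun v hv => absurd (le_bot_iff.1 hv) v.2.1⟩
  bot_le x := show (⊥ : P) ≤ x.1 from bot_le

instance [Finite P] : Finite (InducedSubcomplex X) :=
  Subtype.finite

variable {X}

theorem InducedSubcomplex.isAtom_val {v : InducedSubcomplex X} (hv : IsAtom v) : IsAtom v.1 := by
  refine ⟨fun h => hv.1 (Subtype.ext h), fun b hb => ?_⟩
  have := hv.2 ⟨b, fun u hu => v.2 u (hu.trans hb.le)⟩ (show b < v.1 from hb)
  exact congrArg Subtype.val this

/-- The restriction of a labelling of vertices to an induced subcomplex. -/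
def restrictLabel {α : Type v} (label : Vertex P → α) (v : Vertex (InducedSubcomplex X)) : α :=
  label ⟨v.1.1, InducedSubcomplex.isAtom_val v.2⟩

end Induced

/-! # Graded free complexes over a polynomial ring -/

/-- Every monomial `s` of `p` satisfies `deg s + b = a`, that is, `p` is zero or homogeneous of
degree `a - b`. -/
def IsHomogeneousEntry {σ : Type u} {k : Type v} [CommSemiring k]
    (p : MvPolynomial σ k) (a b : ℕ) : Prop :=
  ∀ s ∈ p.support, s.degree + b = a

/-- The data `⋯ → F₂ → F₁ → F₀ → R` of a sequence of free modules `Fᵢ` over the polynomial ring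
`R = k[σ]` with bases `B i`, degrees of the basis elements, and maps given on the bases. -/
structure FreeSequence (σ : Type u) (k : Type v) [CommRing k] where
  B : ℕ → Type w
  deg : ∀ i, B i → ℕ
  d : ∀ i, B (i + 1) → (B i →₀ MvPolynomial σ k)
  aug : B 0 → MvPolynomial σ k

namespace FreeSequence

variable {σ : Type u} {k : Type v} [CommRing k]

/-- The differential `F_{i+1} → F_i` as a linear map. -/
def dMap (F : FreeSequence.{u, v, w} σ k) (i : ℕ) :
    (F.B (i + 1) →₀ MvPolynomial σ k) →ₗ[MvPolynomial σ k] (F.B i →₀ MvPolynomial σ k) :=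
  Finsupp.linearCombination (MvPolynomial σ k) (F.d i)

/-- The augmentation `F_0 → R` as a linear map. -/
def augMap (F : FreeSequence.{u, v, w} σ k) :
    (F.B 0 →₀ MvPolynomial σ k) →ₗ[MvPolynomial σ k] MvPolynomial σ k :=
  Finsupp.linearCombination (MvPolynomial σ k) F.aug

/-- `F` is a minimal graded free resolution of the ideal `I`, with augmentation `F₀ → I ⊆ R`:
finitely generated free modules, homogeneous maps of degree `0`, exactness, and differentials
with entries in the homogeneous maximal ideal. -/
structure IsMinimalFreeResolution (F : FreeSequence.{u, v, w} σ k)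
    (I : Ideal (MvPolynomial σ k)) : Prop where
  finite : ∀ i, Finite (F.B i)
  aug_homogeneous : ∀ b, IsHomogeneousEntry (F.aug b) (F.deg 0 b) 0
  d_homogeneous : ∀ i b c, IsHomogeneousEntry (F.d i b c) (F.deg (i + 1) b) (F.deg i c)
  range_aug : LinearMap.range F.augMap = I
  exact_zero : LinearMap.ker F.augMap = LinearMap.range (F.dMap 0)
  exact_succ : ∀ i, LinearMap.ker (F.dMap i) = LinearMap.range (F.dMap (i + 1))
  minimal : ∀ i b c, MvPolynomial.constantCoeff (F.d i b c) = 0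

/-- The initial degree of `F₀`. -/
def initialDegree (F : FreeSequence.{u, v, w} σ k) : ℕ := sInf (Set.range (F.deg 0))

/-- The linear strand of `F`: if `F₀` has initial degree `d`, the differentials are restricted to
the free modules on the basis elements of degree `d + i` of `Fᵢ`. (When `F` is minimal, the
differential maps these free submodules to each other, so no entry is lost.) -/
def linearStrand (F : FreeSequence.{u, v, w} σ k) : FreeSequence.{u, v, w} σ k where
  B i := {b : F.B i // F.deg i b = F.initialDegree + i}
  deg i b := F.deg i b.1
  d i b := (F.d i b.1).subtypeDomain (fun c => F.deg i c = F.initialDegree + i)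
  aug b := F.aug b.1

/-- An isomorphism of augmented complexes of graded free modules: bijective linear maps,
homogeneous of degree `0`, that commute with the differentials and the augmentations. -/
structure GradedIso (F : FreeSequence.{u, v, w} σ k) (G : FreeSequence.{u, v, w'} σ k) where
  equiv : ∀ i, (F.B i →₀ MvPolynomial σ k) ≃ₗ[MvPolynomial σ k] (G.B i →₀ MvPolynomial σ k)
  homogeneous : ∀ i b c, IsHomogeneousEntry (equiv i (Finsupp.single b 1) c) (F.deg i b) (G.deg i c)
  comm_d : ∀ i f, equiv i (F.dMap i f) = G.dMap i (equiv (i + 1) f)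
  comm_aug : ∀ f, G.augMap (equiv 0 f) = F.augMap f

end FreeSequence

/-! # Monomial ideals -/

/-- `I` is generated by monomials; a monomial is represented by its exponent vector. -/
def IsMonomialIdeal {σ : Type u} {k : Type v} [CommRing k]
    (I : Ideal (MvPolynomial σ k)) : Prop :=
  ∃ S : Set (σ →₀ ℕ), I = Ideal.span ((fun s => MvPolynomial.monomial s (1 : k)) '' S)

/-- `G(I)`: the (exponents of the) monomials in `I` that are minimal under divisibility. For a
monomial ideal this is its minimal set of monomial generators. -/
def minimalGenerators {σ : Type u} {k : Type v} [CommRing k]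
    (I : Ideal (MvPolynomial σ k)) : Set (σ →₀ ℕ) :=
  {s | Minimal (fun t => MvPolynomial.monomial t (1 : k) ∈ I) s}

/-- The vertices whose labels belong to `G(J)`. -/
def generatorVertices {σ : Type u} {k : Type v} [CommRing k] {P : Type w} [PartialOrder P]
    [OrderBot P] (label : Vertex P → σ →₀ ℕ) (J : Ideal (MvPolynomial σ k)) : Set (Vertex P) :=
  {v | label v ∈ minimalGenerators J}

/-- `J` has a linear minimal free resolution: for some `d`, all basis elements of the `i`-th free
module have degree `d + i`. -/
def HasLinearResolution {σ : Type u} {k : Type v} [CommRing k]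
    (J : Ideal (MvPolynomial σ k)) : Prop :=
  ∃ F : FreeSequence.{u, v, 0} σ k, F.IsMinimalFreeResolution J ∧
    ∀ i b, F.deg i b = F.initialDegree + i

/-! # Cellular complexes -/

section Cellular

variable {σ : Type u} {P : Type w} [PartialOrder P] [OrderBot P] [Finite P]

/-- The multidegree of a face: the least common multiple of the labels of its vertices. -/
def multidegree (label : Vertex P → σ →₀ ℕ) (x : P) : σ →₀ ℕ :=
  (Set.toFinite {v : Vertex P | v.1 ≤ x}).toFinset.sup label

/-- The cellular complex of the labelled complex `P` over `R = k[σ]`: its `i`-th free module has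
the basis `e_x`, `x` an `i`-dimensional face, with `deg e_x = deg m_x`; the differential is
`e_x ↦ ∑_y ε(x, y) (m_x / m_y) e_y`, and the augmentation sends `e_v` to `m_v`. -/
def cellularComplex (k : Type v) [CommRing k] (label : Vertex P → σ →₀ ℕ) (ε : P → P → ℤ) :
    FreeSequence.{u, v, w} σ k where
  B i := Cell P i
  deg _ x := (multidegree label x.1).degree
  d _ x := Finsupp.equivFunOnFinite.symm fun y =>
    MvPolynomial.monomial (multidegree label x.1 - multidegree label y.1) ((ε x.1 y.1 : ℤ) : k)
  aug x := MvPolynomial.monomial (multidegree label x.1) 1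

/-- The labelled complex `P` supports the linear strand of (the minimal graded free resolution of)
the ideal `I`. -/
def SupportsLinearStrand {k : Type v} [CommRing k] (label : Vertex P → σ →₀ ℕ)
    (I : Ideal (MvPolynomial σ k)) : Prop :=
  ∃ ε : P → P → ℤ, IsIncidenceFunction ε ∧
    ∃ F : FreeSequence.{u, v, 0} σ k, F.IsMinimalFreeResolution I ∧
      Nonempty ((cellularComplex k label ε).GradedIso F.linearStrand)

/-- The labelled complex `P` supports a minimal free resolution of `I`. -/
def SupportsMinimalResolution {k : Type v} [CommRing k] (label : Vertex P → σ →₀ ℕ)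
    (I : Ideal (MvPolynomial σ k)) : Prop :=
  ∃ ε : P → P → ℤ, IsIncidenceFunction ε ∧
    (cellularComplex k label ε).IsMinimalFreeResolution I

end Cellular

end

/-!
# Restricting the linear strand of a monomial ideal that is supported on a regular CW complex

*Linear strands.* Up to isomorphism the linear strand of a minimal graded free resolution of `J` is
the only complex `C` of free modules such that `Cᵢ` is generated in degree `d + i`, the augmentation
identifies the part of degree `d` of `C₀` with that of `J`, and the differential identifies the part
of degree `d + i + 1` of `Cᵢ₊₁` with the cycles of that degree in `Cᵢ`. This property is
`FreeSequence.IsLinearStrandOf`; it holds by `FreeSequence.IsMinimalFreeResolution.isLinearStrandOf`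
and determines the complex by `FreeSequence.IsLinearStrandOf.nonempty_gradedIso`. Minimal graded
free resolutions exist by `exists_isMinimalFreeResolution`. So it suffices to prove the property for
the cellular complex of the induced subcomplex, knowing it for that of the whole complex.

*The restriction.* The cellular complex of the induced subcomplex is a subcomplex of the whole one,
and only one point is not immediate: if the boundary of a linear combination of `(i + 1)`-cells lies
in the induced subcomplex, so do the cells. A cell outside of the induced subcomplex has a facet
outside of it, so it is enough that the coefficient of a facet in the boundary does not cancel.
Cancellation could only occur between two cells with the same multidegree and a common facet.

*Cells with the same multidegree.* By induction on the dimension, two cells of the same dimension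
with the same multidegree and a common facet are equal
(`LinearLabelling.eq_of_common_facet`). For edges this is the hypothesis. In the
step, an interval `[t, q]` of length two with `t` nonempty has, since the signs of an incidence
function cancel, at least two elements in the middle; the multidegree grows by one variable at each
step, and by the induction the first variable determines the element in the middle, so there are
exactly two, with the two variables in opposite orders (`LinearLabelling.exists_swap`). Hence two
cells `q`, `q'` with the same multidegree that share a facet `s` share the facets adjacent to `s`,
with the same ratio of signs. The same exchange of variables shows that all the facets of `q` that
contain a given vertex are connected through adjacent ones (`LinearLabelling.facets_above`). As the
boundary of `q` is a sphere of positive dimension, it is connected, so `q` and `q'` have the same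
boundary up to a sign. This contradicts the injectivity of the differential in the lowest degree,
unless `q = q'`. The same argument shows along the way that facets have codimension one
(`LinearLabelling.ht_eq_of_covBy`), that is, that the lengths of chains agree with dimensions.
-/

noncomputable section

/-! ### Homogeneous elements of graded free modules -/

section Homogeneous

variable {σ : Type u} {k : Type v} [CommRing k] {A : Type w} {B : Type w'}

theorem isHomogeneousEntry_iff {p : MvPolynomial σ k} {a b : ℕ} :
    IsHomogeneousEntry p a b ↔ ∀ s, p.coeff s ≠ 0 → s.degree + b = a := by
  simp [IsHomogeneousEntry, MvPolynomial.mem_support_iff]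

theorem IsHomogeneousEntry.zero (a b : ℕ) : IsHomogeneousEntry (0 : MvPolynomial σ k) a b := by
  simp [IsHomogeneousEntry]

theorem IsHomogeneousEntry.add {p q : MvPolynomial σ k} {a b : ℕ}
    (hp : IsHomogeneousEntry p a b) (hq : IsHomogeneousEntry q a b) :
    IsHomogeneousEntry (p + q) a b := by
  rw [isHomogeneousEntry_iff] at *
  intro s hs
  by_contra h
  exact hs (by rw [MvPolynomial.coeff_add, not_not.1 (mt (hp s) h), not_not.1 (mt (hq s) h),
    add_zero])

theorem IsHomogeneousEntry.neg {p : MvPolynomial σ k} {a b : ℕ}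
    (hp : IsHomogeneousEntry p a b) : IsHomogeneousEntry (-p) a b := by
  rw [isHomogeneousEntry_iff] at *
  intro s hs
  exact hp s (by simpa using hs)

theorem IsHomogeneousEntry.C (r : k) (a : ℕ) :
    IsHomogeneousEntry (MvPolynomial.C r : MvPolynomial σ k) a a := by
  classical
  rw [isHomogeneousEntry_iff]
  intro s hs
  rw [MvPolynomial.coeff_C] at hs
  have : s = 0 := by
    by_contra h
    exact hs (if_neg (Ne.symm h))
  simp [this]

theorem IsHomogeneousEntry.eq_C {p : MvPolynomial σ k} {a : ℕ} (hp : IsHomogeneousEntry p a a) :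
    p = MvPolynomial.C (MvPolynomial.constantCoeff p) := by
  classical
  rw [isHomogeneousEntry_iff] at hp
  ext s
  rw [MvPolynomial.coeff_C]
  split_ifs with h
  · rw [← h, MvPolynomial.constantCoeff_eq]
  · by_contra hs
    have := hp s hs
    exact h ((Finsupp.degree_eq_zero_iff s).1 (by omega)).symm

theorem IsHomogeneousEntry.eq_zero_of_lt {p : MvPolynomial σ k} {a b : ℕ}
    (hp : IsHomogeneousEntry p a b) (h : a < b) : p = 0 := by
  rw [isHomogeneousEntry_iff] at hp
  ext s
  by_contra hs
  have := hp s (by simpa using hs)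
  omega

theorem IsHomogeneousEntry.constantCoeff_eq_zero {p : MvPolynomial σ k} {a b : ℕ}
    (hp : IsHomogeneousEntry p a b) (h : a ≠ b) : MvPolynomial.constantCoeff p = 0 := by
  rw [isHomogeneousEntry_iff] at hp
  by_contra hs
  have := hp 0 (by rwa [MvPolynomial.constantCoeff_eq] at hs)
  simp at this
  omega

/-- The part of degree `a - b` of a polynomial, which is zero when `a < b`. -/
def entryComponent (a b : ℕ) (p : MvPolynomial σ k) : MvPolynomial σ k :=
  if b ≤ a then MvPolynomial.homogeneousComponent (a - b) p else 0

theorem coeff_entryComponent (a b : ℕ) (p : MvPolynomial σ k) (s : σ →₀ ℕ) :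
    (entryComponent a b p).coeff s = if s.degree + b = a then p.coeff s else 0 := by
  unfold entryComponent
  split_ifs with h1 h2 h2
  · rw [MvPolynomial.coeff_homogeneousComponent, if_pos (by omega)]
  · rw [MvPolynomial.coeff_homogeneousComponent, if_neg (by omega)]
  · omega
  · simp

theorem entryComponent_isHomogeneousEntry (a b : ℕ) (p : MvPolynomial σ k) :
    IsHomogeneousEntry (entryComponent a b p) a b := by
  rw [isHomogeneousEntry_iff]
  intro s hs
  rw [coeff_entryComponent] at hs
  by_contra h
  exact hs (if_neg h)

@[simp]
theorem entryComponent_zero (a b : ℕ) : entryComponent a b (0 : MvPolynomial σ k) = 0 := by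
  simp [entryComponent]

theorem entryComponent_sum {ι : Type*} (t : Finset ι) (a b : ℕ) (p : ι → MvPolynomial σ k) :
    entryComponent a b (∑ i ∈ t, p i) = ∑ i ∈ t, entryComponent a b (p i) := by
  unfold entryComponent
  split_ifs
  · exact map_sum _ _ _
  · simp

theorem IsHomogeneousEntry.entryComponent_self {p : MvPolynomial σ k} {a b : ℕ}
    (hp : IsHomogeneousEntry p a b) : entryComponent a b p = p := by
  rw [isHomogeneousEntry_iff] at hp
  ext s
  rw [coeff_entryComponent]
  split_ifs with h
  · rfl
  · exact (not_not.1 (mt (hp s) h)).symm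

theorem IsHomogeneousEntry.entryComponent_of_ne {p : MvPolynomial σ k} {a a' b : ℕ}
    (hp : IsHomogeneousEntry p a b) (h : a' ≠ a) : entryComponent a' b p = 0 := by
  rw [isHomogeneousEntry_iff] at hp
  ext s
  rw [coeff_entryComponent]
  split_ifs with h'
  · simpa using not_not.1 (mt (hp s) (by omega))
  · simp

theorem entryComponent_mul {p q : MvPolynomial σ k} {b c : ℕ} (a : ℕ)
    (hq : IsHomogeneousEntry q b c) :
    entryComponent a c (p * q) = entryComponent a b p * q := by
  classical
  rw [isHomogeneousEntry_iff] at hq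
  ext s
  rw [coeff_entryComponent, MvPolynomial.coeff_mul, MvPolynomial.coeff_mul]
  have key : ∀ x ∈ Finset.HasAntidiagonal.antidiagonal s,
      (entryComponent a b p).coeff x.1 * q.coeff x.2 =
        if s.degree + c = a then p.coeff x.1 * q.coeff x.2 else 0 := by
    intro x hx
    by_cases hx2 : q.coeff x.2 = 0
    · simp [hx2]
    · have h := hq _ hx2
      rw [coeff_entryComponent, ← Finset.HasAntidiagonal.mem_antidiagonal.1 hx, map_add]
      by_cases h' : x.1.degree + b = a
      · rw [if_pos h', if_pos (by omega)]
      · rw [if_neg h', if_neg (by omega), zero_mul]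
  rw [Finset.sum_congr rfl key]
  split_ifs <;> simp

/-- `f` is homogeneous of degree `e` in the free module whose basis elements have the degrees
`deg`. -/
def IsHomogeneousElement (deg : B → ℕ) (e : ℕ) (f : B →₀ MvPolynomial σ k) : Prop :=
  ∀ b, IsHomogeneousEntry (f b) e (deg b)

/-- The part of degree `e` of an element of the free module whose basis elements have the degrees
`deg`. -/
def component (deg : B → ℕ) (e : ℕ) (f : B →₀ MvPolynomial σ k) : B →₀ MvPolynomial σ k :=
  Finsupp.onFinset f.support (fun b => entryComponent e (deg b) (f b)) fun b hb => by
    rw [Finsupp.mem_support_iff]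
    rintro h
    exact hb (by rw [h, entryComponent_zero])

@[simp]
theorem component_apply (deg : B → ℕ) (e : ℕ) (f : B →₀ MvPolynomial σ k) (b : B) :
    component deg e f b = entryComponent e (deg b) (f b) := rfl

theorem isHomogeneousElement_component (deg : B → ℕ) (e : ℕ) (f : B →₀ MvPolynomial σ k) :
    IsHomogeneousElement deg e (component deg e f) :=
  fun _ => entryComponent_isHomogeneousEntry _ _ _

theorem IsHomogeneousElement.component_self {deg : B → ℕ} {e : ℕ} {f : B →₀ MvPolynomial σ k}
    (h : IsHomogeneousElement deg e f) : component deg e f = f :=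
  Finsupp.ext fun b => (h b).entryComponent_self

theorem IsHomogeneousElement.component_of_ne {deg : B → ℕ} {e e' : ℕ}
    {f : B →₀ MvPolynomial σ k}
    (h : IsHomogeneousElement deg e f) (he : e' ≠ e) : component deg e' f = 0 :=
  Finsupp.ext fun b => (h b).entryComponent_of_ne he

theorem IsHomogeneousElement.zero (deg : B → ℕ) (e : ℕ) :
    IsHomogeneousElement deg e (0 : B →₀ MvPolynomial σ k) :=
  fun _ => IsHomogeneousEntry.zero _ _

theorem IsHomogeneousElement.sub {deg : B → ℕ} {e : ℕ} {f g : B →₀ MvPolynomial σ k}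
    (hf : IsHomogeneousElement deg e f) (hg : IsHomogeneousElement deg e g) :
    IsHomogeneousElement deg e (f - g) := by
  rw [sub_eq_add_neg]
  exact fun b => (hf b).add (hg b).neg

theorem IsHomogeneousElement.single (deg : B → ℕ) {e : ℕ} {b : B} (h : deg b = e) (r : k) :
    IsHomogeneousElement (σ := σ) deg e (Finsupp.single b (MvPolynomial.C r)) := by
  classical
  intro c
  rw [Finsupp.single_apply]
  split_ifs with hc
  · subst hc
    rw [h]
    exact IsHomogeneousEntry.C r e
  · exact IsHomogeneousEntry.zero _ _

theorem linearMap_apply_eq_sum {M : Type*} [AddCommGroup M] [Module (MvPolynomial σ k) M]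
    (φ : (B →₀ MvPolynomial σ k) →ₗ[MvPolynomial σ k] M) (f : B →₀ MvPolynomial σ k)
    {t : Finset B} (ht : f.support ⊆ t) :
    φ f = ∑ b ∈ t, f b • φ (Finsupp.single b 1) := by
  conv_lhs => rw [← Finsupp.sum_single f, Finsupp.sum_of_support_subset f ht _ (by simp), map_sum]
  refine Finset.sum_congr rfl fun b _ => ?_
  rw [← map_smul, Finsupp.smul_single, smul_eq_mul, mul_one]

/-- Homogeneous linear forms commute with taking components. -/
theorem linearForm_component {deg : B → ℕ} {c : ℕ}
    (ψ : (B →₀ MvPolynomial σ k) →ₗ[MvPolynomial σ k] MvPolynomial σ k)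
    (hψ : ∀ b, IsHomogeneousEntry (ψ (Finsupp.single b 1)) (deg b) c) (e : ℕ)
    (f : B →₀ MvPolynomial σ k) :
    ψ (component deg e f) = entryComponent e c (ψ f) := by
  rw [linearMap_apply_eq_sum ψ f subset_rfl, linearMap_apply_eq_sum ψ (component deg e f)
    (t := f.support) Finsupp.support_onFinset_subset, entryComponent_sum]
  refine Finset.sum_congr rfl fun b _ => ?_
  rw [smul_eq_mul, smul_eq_mul, entryComponent_mul e (hψ b), component_apply]

/-- A linear map of graded free modules is homogeneous of degree `0`. -/
def IsHomogeneousMap (deg : B → ℕ) (deg' : A → ℕ)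
    (φ : (B →₀ MvPolynomial σ k) →ₗ[MvPolynomial σ k] (A →₀ MvPolynomial σ k)) : Prop :=
  ∀ b, IsHomogeneousElement deg' (deg b) (φ (Finsupp.single b 1))

theorem IsHomogeneousMap.map_component {deg : B → ℕ} {deg' : A → ℕ}
    {φ : (B →₀ MvPolynomial σ k) →ₗ[MvPolynomial σ k] (A →₀ MvPolynomial σ k)}
    (hφ : IsHomogeneousMap deg deg' φ) (e : ℕ) (f : B →₀ MvPolynomial σ k) :
    φ (component deg e f) = component deg' e (φ f) := by
  ext1 a
  exact linearForm_component (Finsupp.lapply a ∘ₗ φ) (fun b => hφ b a) e f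

theorem IsHomogeneousMap.map_isHomogeneousElement {deg : B → ℕ} {deg' : A → ℕ}
    {φ : (B →₀ MvPolynomial σ k) →ₗ[MvPolynomial σ k] (A →₀ MvPolynomial σ k)}
    (hφ : IsHomogeneousMap deg deg' φ) {e : ℕ} {f : B →₀ MvPolynomial σ k}
    (hf : IsHomogeneousElement deg e f) : IsHomogeneousElement deg' e (φ f) := by
  rw [← hf.component_self, hφ.map_component]
  exact isHomogeneousElement_component _ _ _

theorem component_single {deg : B → ℕ} (b : B) (e : ℕ) :
    component deg e (Finsupp.single b (1 : MvPolynomial σ k)) =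
      if e = deg b then Finsupp.single b 1 else 0 := by
  have h := IsHomogeneousElement.single (σ := σ) deg (rfl : deg b = deg b) (1 : k)
  rw [map_one] at h
  split_ifs with he
  · rw [he, h.component_self]
  · exact h.component_of_ne he

/-- An element all of whose components other than the one of degree `e` vanish is homogeneous. -/
theorem isHomogeneousElement_of_component {deg : B → ℕ} {e : ℕ} {f : B →₀ MvPolynomial σ k}
    (h : ∀ e', e' ≠ e → component deg e' f = 0) : IsHomogeneousElement deg e f := by
  intro b
  rw [isHomogeneousEntry_iff]
  intro s hs
  by_contra hne
  refine hs ?_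
  have := congrArg (fun p => MvPolynomial.coeff s p) (DFunLike.congr_fun (h _ hne) b)
  simpa [coeff_entryComponent] using this

theorem IsHomogeneousMap.symm {deg : B → ℕ} {deg' : A → ℕ}
    {φ : (B →₀ MvPolynomial σ k) ≃ₗ[MvPolynomial σ k] (A →₀ MvPolynomial σ k)}
    (hφ : IsHomogeneousMap deg deg' φ.toLinearMap) :
    IsHomogeneousMap deg' deg φ.symm.toLinearMap := by
  intro a
  refine isHomogeneousElement_of_component fun e he => φ.injective ?_
  have := hφ.map_component e (φ.symm (Finsupp.single a 1))
  simp only [LinearEquiv.coe_coe, LinearEquiv.apply_symm_apply] at this ⊢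
  rw [this, map_zero, component_single, if_neg he]

/-- A homogeneous isomorphism matches the degrees of the basis elements: if all basis elements of
the target have degree `e`, so do those of the source. -/
theorem IsHomogeneousMap.deg_eq [Nontrivial k] {deg : B → ℕ} {deg' : A → ℕ}
    {φ : (B →₀ MvPolynomial σ k) ≃ₗ[MvPolynomial σ k] (A →₀ MvPolynomial σ k)}
    (hφ : IsHomogeneousMap deg deg' φ.toLinearMap) {e : ℕ} (he : ∀ a, deg' a = e) (b : B) :
    deg b = e := by
  by_contra hne
  have h : (1 : MvPolynomial σ k) = φ.symm (φ (Finsupp.single b 1)) b := by simp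
  rw [← LinearEquiv.coe_coe φ.symm, linearMap_apply_eq_sum φ.symm.toLinearMap _ subset_rfl,
    Finsupp.finsetSum_apply] at h
  have h' := congrArg MvPolynomial.constantCoeff h
  rw [map_one, map_sum, Finset.sum_eq_zero] at h'
  · exact one_ne_zero h'
  · intro a _
    have := (hφ b a).constantCoeff_eq_zero (by rw [he]; exact hne)
    rw [LinearEquiv.coe_coe] at this
    rw [Finsupp.smul_apply, smul_eq_mul, map_mul, this, zero_mul]

theorem sum_component (deg : B → ℕ) (f : B →₀ MvPolynomial σ k) :
    ∃ t : Finset ℕ, f = ∑ e ∈ t, component deg e f := by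
  classical
  refine ⟨f.support.biUnion fun b => (f b).support.image fun s => s.degree + deg b, ?_⟩
  ext b s
  rw [Finsupp.finsetSum_apply]
  simp only [component_apply, MvPolynomial.coeff_sum, coeff_entryComponent]
  rw [Finset.sum_ite_eq]
  split_ifs with h
  · rfl
  · by_contra hs
    refine h (Finset.mem_biUnion.2 ⟨b, ?_, Finset.mem_image.2 ⟨s, ?_, rfl⟩⟩)
    · rw [Finsupp.mem_support_iff]
      rintro h0
      simp [h0] at hs
    · rwa [MvPolynomial.mem_support_iff]

end Homogeneous

/-! ### Existence of minimal graded free resolutions -/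

section Existence

variable {σ : Type u} {k : Type v} {A : Type w}

/-- A submodule of a graded free module is homogeneous: it contains the components of its
elements. -/
def IsHomogeneousSubmodule [CommRing k] (deg : A → ℕ)
    (K : Submodule (MvPolynomial σ k) (A →₀ MvPolynomial σ k)) : Prop :=
  ∀ f ∈ K, ∀ e, component deg e f ∈ K

/-- A finite family of homogeneous generators of a submodule of a graded free module. -/
structure HomogeneousGenerators [CommRing k] (deg : A → ℕ)
    (K : Submodule (MvPolynomial σ k) (A →₀ MvPolynomial σ k)) (n : ℕ) where
  deg' : Fin n → ℕ
  gen : Fin n → (A →₀ MvPolynomial σ k)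
  homogeneous : ∀ j, IsHomogeneousElement deg (deg' j) (gen j)
  span_eq : Submodule.span (MvPolynomial σ k) (Set.range gen) = K

theorem exists_homogeneousGenerators [Field k] [Finite σ] [Finite A] (deg : A → ℕ)
    {K : Submodule (MvPolynomial σ k) (A →₀ MvPolynomial σ k)}
    (hK : IsHomogeneousSubmodule deg K) : ∃ n, Nonempty (HomogeneousGenerators deg K n) := by
  classical
  obtain ⟨S, hS⟩ := IsNoetherian.noetherian K
  choose t ht using fun f : A →₀ MvPolynomial σ k => sum_component deg f
  let T : Finset (ℕ × (A →₀ MvPolynomial σ k)) :=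
    S.biUnion fun f => (t f).image fun e => (e, component deg e f)
  have hT : ∀ x ∈ T, ∃ f ∈ S, x.2 = component deg x.1 f := by
    intro x hx
    obtain ⟨f, hf, hx⟩ := Finset.mem_biUnion.1 hx
    obtain ⟨e, _, rfl⟩ := Finset.mem_image.1 hx
    exact ⟨f, hf, rfl⟩
  let E := T.equivFin
  refine ⟨T.card, ⟨⟨fun j => (E.symm j).1.1, fun j => (E.symm j).1.2, fun j => ?_, ?_⟩⟩⟩
  · obtain ⟨f, _, h⟩ := hT _ (E.symm j).2
    rw [h]
    exact isHomogeneousElement_component _ _ _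
  · refine le_antisymm (Submodule.span_le.2 ?_) ?_
    · rintro _ ⟨j, rfl⟩
      obtain ⟨f, hf, h⟩ := hT _ (E.symm j).2
      change (E.symm j).1.2 ∈ K
      rw [h]
      exact hK f (hS ▸ Submodule.subset_span hf) _
    · rw [← hS]
      refine Submodule.span_le.2 fun f hf => ?_
      rw [SetLike.mem_coe, ht f]
      refine Submodule.sum_mem _ fun e he => Submodule.subset_span ?_
      have hx : (e, component deg e f) ∈ T :=
        Finset.mem_biUnion.2 ⟨f, hf, Finset.mem_image.2 ⟨e, he, rfl⟩⟩
      exact ⟨E ⟨_, hx⟩, by simp⟩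

/-- In a family of homogeneous generators with the least number of elements, no relation has a
coefficient with a nonzero constant term: by homogeneity the generator with that coefficient would
be redundant. -/
theorem HomogeneousGenerators.constantCoeff_eq_zero [Field k] {deg : A → ℕ}
    {K : Submodule (MvPolynomial σ k) (A →₀ MvPolynomial σ k)} {n : ℕ}
    (g : HomogeneousGenerators deg K n)
    (hmin : ∀ m, Nonempty (HomogeneousGenerators deg K m) → n ≤ m) (f : Fin n →₀ MvPolynomial σ k)
    (hf : Finsupp.linearCombination (MvPolynomial σ k) g.gen f = 0) (j : Fin n) :
    MvPolynomial.constantCoeff (f j) = 0 := by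
  classical
  by_contra hj
  obtain ⟨m, rfl⟩ : ∃ m, n = m + 1 := ⟨n - 1, by have := j.pos; omega⟩
  have hhom : IsHomogeneousMap g.deg' deg (Finsupp.linearCombination (MvPolynomial σ k) g.gen) := by
    intro b
    simpa using g.homogeneous b
  have h0 := hhom.map_component (g.deg' j) f
  rw [hf, (IsHomogeneousElement.zero deg (g.deg' j)).component_self] at h0
  set f' := component g.deg' (g.deg' j) f
  have hfj : f' j = MvPolynomial.C (MvPolynomial.constantCoeff (f j)) := by
    rw [component_apply, (entryComponent_isHomogeneousEntry _ _ _).eq_C,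
      MvPolynomial.constantCoeff_eq, coeff_entryComponent]
    simp
  set c := MvPolynomial.constantCoeff (f j)
  let N := Submodule.span (MvPolynomial σ k) (Set.range (g.gen ∘ j.succAbove))
  have hmem : g.gen j ∈ N := by
    rw [Finsupp.linearCombination_apply, Finsupp.sum_fintype _ _ (by simp),
      Fin.sum_univ_succAbove _ j, hfj] at h0
    have h1 : (MvPolynomial.C c : MvPolynomial σ k) • g.gen j ∈ N := by
      rw [eq_neg_of_add_eq_zero_left h0]
      refine N.neg_mem (N.sum_mem fun i _ => N.smul_mem _ (Submodule.subset_span ⟨i, rfl⟩))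
    have h2 := N.smul_mem (MvPolynomial.C c⁻¹) h1
    rwa [smul_smul, ← map_mul, inv_mul_cancel₀ hj, map_one, one_smul] at h2
  have := hmin m ⟨⟨g.deg' ∘ j.succAbove, g.gen ∘ j.succAbove, fun i => g.homogeneous _, ?_⟩⟩
  · omega
  · refine Eq.trans ?_ g.span_eq
    refine le_antisymm (Submodule.span_mono (Set.range_comp_subset_range _ _))
      (Submodule.span_le.2 ?_)
    rintro _ ⟨i, rfl⟩
    rcases eq_or_ne i j with rfl | hij
    · exact hmem
    · obtain ⟨l, rfl⟩ := Fin.exists_succAbove_eq hij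
      exact Submodule.subset_span ⟨l, rfl⟩

/-- A homogeneous submodule `K` of a graded free module of finite rank: the data from which a
resolution continues. -/
structure SyzygyModule (σ : Type u) (k : Type v) [CommRing k] where
  rank : ℕ
  deg : Fin rank → ℕ
  K : Submodule (MvPolynomial σ k) (Fin rank →₀ MvPolynomial σ k)
  homogeneous : IsHomogeneousSubmodule deg K

/-- Every homogeneous submodule of a graded free module of finite rank is the image of a minimal
graded free cover. -/
theorem exists_minimal_cover [Field k] [Finite σ] [Finite A] (deg : A → ℕ)
    {K : Submodule (MvPolynomial σ k) (A →₀ MvPolynomial σ k)}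
    (hK : IsHomogeneousSubmodule deg K) :
    ∃ (T : SyzygyModule σ k) (φ : Fin T.rank → (A →₀ MvPolynomial σ k)),
      (∀ j, IsHomogeneousElement deg (T.deg j) (φ j)) ∧
      LinearMap.range (Finsupp.linearCombination (MvPolynomial σ k) φ) = K ∧
      LinearMap.ker (Finsupp.linearCombination (MvPolynomial σ k) φ) = T.K ∧
      ∀ f ∈ T.K, ∀ j, MvPolynomial.constantCoeff (f j) = 0 := by
  classical
  have h := exists_homogeneousGenerators deg hK
  obtain ⟨g⟩ := Nat.find_spec h
  have hhom : IsHomogeneousMap g.deg' deg (Finsupp.linearCombination (MvPolynomial σ k) g.gen) := by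
    intro b
    simpa using g.homogeneous b
  refine ⟨⟨_, g.deg', LinearMap.ker (Finsupp.linearCombination (MvPolynomial σ k) g.gen), ?_⟩,
    g.gen, g.homogeneous, ?_, rfl, ?_⟩
  · intro f hf e
    rw [LinearMap.mem_ker] at hf ⊢
    rw [hhom.map_component, hf, (IsHomogeneousElement.zero deg e).component_self]
  · rw [Finsupp.range_linearCombination, g.span_eq]
  · exact fun f hf j => g.constantCoeff_eq_zero (fun m hm => Nat.find_min' h hm) f hf j

/-- An ideal that contains the homogeneous components of its elements has a minimal graded free
resolution. -/
theorem exists_isMinimalFreeResolution [Field k] [Finite σ] (J : Ideal (MvPolynomial σ k))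
    (hJ : ∀ p ∈ J, ∀ e, entryComponent e 0 p ∈ J) :
    ∃ F : FreeSequence.{u, v, 0} σ k, F.IsMinimalFreeResolution J := by
  classical
  let J' : Submodule (MvPolynomial σ k) (Unit →₀ MvPolynomial σ k) :=
    Submodule.comap (Finsupp.lapply ()) J
  obtain ⟨T₀, φ₀, hhom₀, hrange₀, hker₀, hmin₀⟩ :=
    exists_minimal_cover (fun _ : Unit => 0) (K := J') fun f hf e => hJ _ hf e
  have hstep := fun T : SyzygyModule σ k => exists_minimal_cover T.deg T.homogeneous
  choose next φ hhom hrange hker hmin using hstep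
  let T : ℕ → SyzygyModule σ k := fun i => Nat.rec T₀ (fun _ => next) i
  have hmin' : ∀ i, ∀ f ∈ (T i).K, ∀ j, MvPolynomial.constantCoeff (f j) = 0 := by
    rintro (_ | i)
    · exact hmin₀
    · exact hmin (T i)
  let F : FreeSequence.{u, v, 0} σ k :=
    { B := fun i => Fin (T i).rank
      deg := fun i => (T i).deg
      d := fun i => φ (T i)
      aug := fun b => φ₀ b () }
  have haug : F.augMap = (Finsupp.lapply ()) ∘ₗ
      Finsupp.linearCombination (MvPolynomial σ k) φ₀ := by
    ext b
    simp [F, FreeSequence.augMap]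
  have hinj : Function.Injective
      (Finsupp.lapply () : (Unit →₀ MvPolynomial σ k) →ₗ[MvPolynomial σ k] _) :=
    fun f g h => Finsupp.ext fun _ => h
  refine ⟨F, ⟨fun i => inferInstanceAs (Finite (Fin _)), fun b => hhom₀ b (),
    fun i b c => hhom (T i) b c, ?_, ?_, ?_, ?_⟩⟩
  · rw [haug, LinearMap.range_comp, hrange₀]
    refine Submodule.map_comap_eq_of_surjective (fun p => ⟨Finsupp.single () p, by simp⟩) _
  · rw [haug, LinearMap.ker_comp_of_ker_eq_bot _ (LinearMap.ker_eq_bot.2 hinj), hker₀]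
    exact (hrange (T 0)).symm
  · exact fun i => (hker (T i)).trans (hrange (T (i + 1))).symm
  · intro i b c
    refine hmin' i (φ (T i) b) ?_ c
    rw [← hrange (T i)]
    exact ⟨Finsupp.single b 1, by simp⟩

end Existence

/-! ### Linear strands up to isomorphism -/

namespace FreeSequence

section Strand

variable {σ : Type u} {k : Type v} [CommRing k]

/-- The kernel of the map that leaves `Fᵢ`: the augmentation if `i = 0`, the differential
otherwise. -/
def cycles (F : FreeSequence.{u, v, w} σ k) :
    ∀ i, Submodule (MvPolynomial σ k) (F.B i →₀ MvPolynomial σ k)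
  | 0 => LinearMap.ker F.augMap
  | i + 1 => LinearMap.ker (F.dMap i)

/-- An intrinsic description of the linear strand, in the degrees `d + i`, of a minimal graded
free resolution of `J`: the basis elements of the `i`-th free module `Cᵢ` have degree `d + i`, the
augmentation identifies the part of degree `d` of `C₀` with that of `J`, and the differential
identifies the part of degree `d + i + 1` of `Cᵢ₊₁` with the cycles of that degree in `Cᵢ`. -/
structure IsLinearStrandOf (C : FreeSequence.{u, v, w} σ k)
    (J : Ideal (MvPolynomial σ k)) (d : ℕ) : Prop where
  deg_eq : ∀ i b, C.deg i b = d + i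
  aug_homogeneous : ∀ b, IsHomogeneousEntry (C.aug b) (C.deg 0 b) 0
  d_homogeneous : ∀ i b c, IsHomogeneousEntry (C.d i b c) (C.deg (i + 1) b) (C.deg i c)
  d_mem_cycles : ∀ i b, C.d i b ∈ C.cycles i
  aug_mem : ∀ b, C.aug b ∈ J
  aug_surjective : ∀ p ∈ J, IsHomogeneousEntry p d 0 →
    ∃ f, IsHomogeneousElement (C.deg 0) d f ∧ C.augMap f = p
  aug_injective : ∀ f, IsHomogeneousElement (C.deg 0) d f → C.augMap f = 0 → f = 0
  d_surjective : ∀ i, ∀ f ∈ C.cycles i, IsHomogeneousElement (C.deg i) (d + (i + 1)) f →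
    ∃ g, IsHomogeneousElement (C.deg (i + 1)) (d + (i + 1)) g ∧ C.dMap i g = f
  d_injective : ∀ i g, IsHomogeneousElement (C.deg (i + 1)) (d + (i + 1)) g →
    C.dMap i g = 0 → g = 0

@[simp]
theorem dMap_single (F : FreeSequence.{u, v, w} σ k) (i : ℕ) (b : F.B (i + 1)) :
    F.dMap i (Finsupp.single b 1) = F.d i b := by
  simp [dMap]

@[simp]
theorem augMap_single (F : FreeSequence.{u, v, w} σ k) (b : F.B 0) :
    F.augMap (Finsupp.single b 1) = F.aug b := by
  simp [augMap]

theorem dMap_isHomogeneousMap {F : FreeSequence.{u, v, w} σ k}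
    (h : ∀ i b c, IsHomogeneousEntry (F.d i b c) (F.deg (i + 1) b) (F.deg i c)) (i : ℕ) :
    IsHomogeneousMap (F.deg (i + 1)) (F.deg i) (F.dMap i) := by
  intro b c
  simpa using h i b c

theorem augMap_component {F : FreeSequence.{u, v, w} σ k}
    (h : ∀ b, IsHomogeneousEntry (F.aug b) (F.deg 0 b) 0) (e : ℕ)
    (f : F.B 0 →₀ MvPolynomial σ k) :
    F.augMap (component (F.deg 0) e f) = entryComponent e 0 (F.augMap f) :=
  linearForm_component F.augMap (fun b => by simpa using h b) e f

theorem dMap_mem_cycles {C : FreeSequence.{u, v, w} σ k}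
    (h : ∀ i b, C.d i b ∈ C.cycles i) (i : ℕ) (f : C.B (i + 1) →₀ MvPolynomial σ k) :
    C.dMap i f ∈ C.cycles i := by
  rw [linearMap_apply_eq_sum (C.dMap i) f subset_rfl]
  refine Submodule.sum_mem _ fun b _ => Submodule.smul_mem _ _ ?_
  rw [dMap_single]
  exact h i b

/-- An isomorphism of augmented complexes preserves the cycles. -/
theorem GradedIso.mem_cycles_iff {C : FreeSequence.{u, v, w} σ k}
    {G : FreeSequence.{u, v, w'} σ k} (φ : C.GradedIso G) (i : ℕ)
    (f : C.B i →₀ MvPolynomial σ k) : φ.equiv i f ∈ G.cycles i ↔ f ∈ C.cycles i := by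
  cases i with
  | zero => simp only [cycles, LinearMap.mem_ker, φ.comm_aug]
  | succ i =>
    simp only [cycles, LinearMap.mem_ker, ← φ.comm_d]
    exact (φ.equiv i).map_eq_zero_iff

theorem GradedIso.isHomogeneousMap {C : FreeSequence.{u, v, w} σ k}
    {G : FreeSequence.{u, v, w'} σ k} (φ : C.GradedIso G) (i : ℕ) :
    IsHomogeneousMap (C.deg i) (G.deg i) (φ.equiv i).toLinearMap :=
  fun b c => φ.homogeneous i b c

theorem IsLinearStrandOf.of_gradedIso [Nontrivial k] {C : FreeSequence.{u, v, w} σ k}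
    {G : FreeSequence.{u, v, w'} σ k} {J : Ideal (MvPolynomial σ k)} {d : ℕ}
    (hG : G.IsLinearStrandOf J d) (φ : C.GradedIso G)
    (haug : ∀ b, IsHomogeneousEntry (C.aug b) (C.deg 0 b) 0)
    (hd : ∀ i b c, IsHomogeneousEntry (C.d i b c) (C.deg (i + 1) b) (C.deg i c)) :
    C.IsLinearStrandOf J d := by
  have hφ := φ.isHomogeneousMap
  have hψ := fun i => (hφ i).symm
  have hsymm : ∀ i g, (φ.equiv i).symm (G.dMap i g) = C.dMap i ((φ.equiv (i + 1)).symm g) := by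
    intro i g
    rw [LinearEquiv.symm_apply_eq, φ.comm_d, LinearEquiv.apply_symm_apply]
  have hGd := fun i => G.dMap_mem_cycles hG.d_mem_cycles i
  refine ⟨fun i b => (hφ i).deg_eq (hG.deg_eq i) b, haug, hd, ?_, ?_, ?_, ?_, ?_, ?_⟩
  · intro i b
    rw [← φ.mem_cycles_iff, ← dMap_single, φ.comm_d]
    exact hGd i _
  · intro b
    rw [← augMap_single, ← φ.comm_aug, linearMap_apply_eq_sum G.augMap _ subset_rfl]
    refine Submodule.sum_mem _ fun c _ => J.mul_mem_left _ ?_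
    rw [augMap_single]
    exact hG.aug_mem c
  · intro p hp hpd
    obtain ⟨f, hf, rfl⟩ := hG.aug_surjective p hp hpd
    refine ⟨(φ.equiv 0).symm f, (hψ 0).map_isHomogeneousElement hf, ?_⟩
    rw [← φ.comm_aug, LinearEquiv.apply_symm_apply]
  · intro f hf h0
    rw [← φ.comm_aug] at h0
    exact (φ.equiv 0).map_eq_zero_iff.1
      (hG.aug_injective _ ((hφ 0).map_isHomogeneousElement hf) h0)
  · intro i f hf hfd
    obtain ⟨g, hg, hgf⟩ := hG.d_surjective i _ ((φ.mem_cycles_iff i f).2 hf)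
      ((hφ i).map_isHomogeneousElement hfd)
    refine ⟨(φ.equiv (i + 1)).symm g, (hψ (i + 1)).map_isHomogeneousElement hg, ?_⟩
    rw [← hsymm, hgf, LinearEquiv.symm_apply_apply]
  · intro i g hg h0
    refine (φ.equiv (i + 1)).map_eq_zero_iff.1
      (hG.d_injective i _ ((hφ (i + 1)).map_isHomogeneousElement hg) ?_)
    rw [← φ.comm_d, h0, map_zero]

end Strand

section Inclusion

variable {σ : Type u} {k : Type v} [CommRing k]

/-- The inclusion of a subcomplex of free modules that is spanned by basis elements. -/
structure BasisInclusion (C : FreeSequence.{u, v, w} σ k) (G : FreeSequence.{u, v, w'} σ k) where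
  toFun : ∀ i, C.B i → G.B i
  injective : ∀ i, Function.Injective (toFun i)
  deg_eq : ∀ i b, G.deg i (toFun i b) = C.deg i b
  aug_eq : ∀ b, G.aug (toFun 0 b) = C.aug b
  d_eq : ∀ i b, G.d i (toFun (i + 1) b) = Finsupp.mapDomain (toFun i) (C.d i b)

namespace BasisInclusion

variable {C : FreeSequence.{u, v, w} σ k} {G : FreeSequence.{u, v, w'} σ k}
  (ι : C.BasisInclusion G)

/-- The inclusion as a linear map. -/
def map (i : ℕ) :
    (C.B i →₀ MvPolynomial σ k) →ₗ[MvPolynomial σ k] (G.B i →₀ MvPolynomial σ k) :=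
  Finsupp.lmapDomain _ _ (ι.toFun i)

theorem map_single (i : ℕ) (b : C.B i) (p : MvPolynomial σ k) :
    ι.map i (Finsupp.single b p) = Finsupp.single (ι.toFun i b) p :=
  Finsupp.mapDomain_single

theorem map_injective (i : ℕ) : Function.Injective (ι.map i) :=
  Finsupp.mapDomain_injective (ι.injective i)

theorem map_apply (i : ℕ) (f : C.B i →₀ MvPolynomial σ k) (b : C.B i) :
    ι.map i f (ι.toFun i b) = f b :=
  Finsupp.mapDomain_apply (ι.injective i) f b

theorem map_apply_of_notMem (i : ℕ) (f : C.B i →₀ MvPolynomial σ k) (b : G.B i)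
    (hb : b ∉ Set.range (ι.toFun i)) : ι.map i f b = 0 :=
  Finsupp.mapDomain_of_notMem_range f b hb

theorem exists_map_eq (i : ℕ) (g : G.B i →₀ MvPolynomial σ k)
    (hg : ∀ b, g b ≠ 0 → b ∈ Set.range (ι.toFun i)) : ∃ f, ι.map i f = g := by
  refine ⟨g.comapDomain (ι.toFun i) (ι.injective i).injOn, Finsupp.ext fun b => ?_⟩
  by_cases hb : b ∈ Set.range (ι.toFun i)
  · obtain ⟨b, rfl⟩ := hb
    rw [map_apply, Finsupp.comapDomain_apply]
  · rw [map_apply_of_notMem _ _ _ _ hb]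
    exact (not_not.1 (mt (hg b) hb)).symm

theorem isHomogeneousElement_iff (i e : ℕ) (f : C.B i →₀ MvPolynomial σ k) :
    IsHomogeneousElement (G.deg i) e (ι.map i f) ↔ IsHomogeneousElement (C.deg i) e f := by
  constructor
  · intro h b
    have := h (ι.toFun i b)
    rwa [map_apply, ι.deg_eq] at this
  · intro h b
    by_cases hb : b ∈ Set.range (ι.toFun i)
    · obtain ⟨b, rfl⟩ := hb
      rw [map_apply, ι.deg_eq]
      exact h b
    · rw [map_apply_of_notMem _ _ _ _ hb]
      exact IsHomogeneousEntry.zero _ _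

theorem augMap_map (f : C.B 0 →₀ MvPolynomial σ k) : G.augMap (ι.map 0 f) = C.augMap f := by
  refine LinearMap.congr_fun (f := G.augMap ∘ₗ ι.map 0) ?_ f
  ext1 b
  ext1
  simp only [LinearMap.comp_apply, Finsupp.lsingle_apply, map_single, augMap_single, ι.aug_eq]

theorem dMap_map (i : ℕ) (f : C.B (i + 1) →₀ MvPolynomial σ k) :
    G.dMap i (ι.map (i + 1) f) = ι.map i (C.dMap i f) := by
  refine LinearMap.congr_fun (f := G.dMap i ∘ₗ ι.map (i + 1)) (g := ι.map i ∘ₗ C.dMap i) ?_ f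
  ext1 b
  ext1
  simp only [LinearMap.comp_apply, Finsupp.lsingle_apply, map_single, dMap_single, ι.d_eq]
  rfl

theorem mem_cycles_iff (i : ℕ) (f : C.B i →₀ MvPolynomial σ k) :
    ι.map i f ∈ G.cycles i ↔ f ∈ C.cycles i := by
  cases i with
  | zero => simp only [cycles, LinearMap.mem_ker, augMap_map]
  | succ i =>
    simp only [cycles, LinearMap.mem_ker, dMap_map]
    exact map_eq_zero_iff _ (ι.map_injective i)

theorem d_mem_cycles {i : ℕ} {b : C.B (i + 1)} (h : G.d i (ι.toFun (i + 1) b) ∈ G.cycles i) :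
    C.d i b ∈ C.cycles i := by
  rw [← ι.mem_cycles_iff]
  rwa [ι.d_eq] at h

end BasisInclusion

end Inclusion

section Resolution

variable {σ : Type u} {k : Type v} [CommRing k] {F : FreeSequence.{u, v, w} σ k}
  {J : Ideal (MvPolynomial σ k)}

theorem IsMinimalFreeResolution.exact (hF : F.IsMinimalFreeResolution J) (i : ℕ) :
    F.cycles i = LinearMap.range (F.dMap i) := by
  cases i with
  | zero => exact hF.exact_zero
  | succ i => exact hF.exact_succ i

theorem IsMinimalFreeResolution.aug_mem (hF : F.IsMinimalFreeResolution J) (b : F.B 0) :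
    F.aug b ∈ J := by
  rw [← hF.range_aug]
  exact ⟨Finsupp.single b 1, F.augMap_single b⟩

theorem IsMinimalFreeResolution.constantCoeff_dMap (hF : F.IsMinimalFreeResolution J) (i : ℕ)
    (f : F.B (i + 1) →₀ MvPolynomial σ k) (c : F.B i) :
    MvPolynomial.constantCoeff (F.dMap i f c) = 0 := by
  rw [linearMap_apply_eq_sum (F.dMap i) f subset_rfl, Finsupp.finsetSum_apply, map_sum]
  refine Finset.sum_eq_zero fun b _ => ?_
  rw [dMap_single, Finsupp.smul_apply, smul_eq_mul, map_mul, hF.minimal, mul_zero]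

theorem IsMinimalFreeResolution.single_notMem_cycles [Nontrivial k]
    (hF : F.IsMinimalFreeResolution J) (i : ℕ) (b : F.B i) :
    Finsupp.single b 1 ∉ F.cycles i := by
  rw [hF.exact]
  rintro ⟨f, hf⟩
  have := hF.constantCoeff_dMap i f b
  rw [hf] at this
  simp at this

/-- In a minimal graded free resolution, the basis elements of `Fᵢ` have degree at least
`d + i`, `d` the initial degree. -/
theorem IsMinimalFreeResolution.le_deg [Nontrivial k] (hF : F.IsMinimalFreeResolution J) (i : ℕ)
    (b : F.B i) : F.initialDegree + i ≤ F.deg i b := by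
  induction i with
  | zero => exact Nat.sInf_le ⟨b, rfl⟩
  | succ i ih =>
    have h : F.d i b ≠ 0 := by
      rintro h
      refine hF.single_notMem_cycles (i + 1) b ?_
      rw [cycles, LinearMap.mem_ker, dMap_single, h]
    obtain ⟨c, hc⟩ := Finsupp.ne_iff.1 h
    obtain ⟨s, hs⟩ := MvPolynomial.ne_zero_iff.1 hc
    have hdeg := isHomogeneousEntry_iff.1 (hF.d_homogeneous i b c) s hs
    have hs0 : s.degree ≠ 0 := by
      rw [ne_eq, Finsupp.degree_eq_zero_iff]
      rintro rfl
      exact hs (by rw [← MvPolynomial.constantCoeff_eq, hF.minimal])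
    have := ih c
    omega

/-- The cycles of degree `e` of a minimal graded free resolution are the boundaries of elements of
degree `e`. -/
theorem IsMinimalFreeResolution.exists_homogeneous (hF : F.IsMinimalFreeResolution J) {i e : ℕ}
    {f : F.B i →₀ MvPolynomial σ k} (hf : f ∈ F.cycles i)
    (hfe : IsHomogeneousElement (F.deg i) e f) :
    ∃ g, IsHomogeneousElement (F.deg (i + 1)) e g ∧ F.dMap i g = f := by
  rw [hF.exact] at hf
  obtain ⟨g, rfl⟩ := hf
  refine ⟨component _ e g, isHomogeneousElement_component _ _ _, ?_⟩
  rw [(dMap_isHomogeneousMap hF.d_homogeneous i).map_component, hfe.component_self]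

theorem IsMinimalFreeResolution.exists_homogeneous_aug (hF : F.IsMinimalFreeResolution J) {e : ℕ}
    {p : MvPolynomial σ k} (hp : p ∈ J) (hpe : IsHomogeneousEntry p e 0) :
    ∃ g, IsHomogeneousElement (F.deg 0) e g ∧ F.augMap g = p := by
  rw [← hF.range_aug] at hp
  obtain ⟨g, rfl⟩ := hp
  refine ⟨component _ e g, isHomogeneousElement_component _ _ _, ?_⟩
  rw [augMap_component hF.aug_homogeneous, hpe.entryComponent_self]

/-- A cycle of `Fᵢ` of the lowest possible degree vanishes, for it would be the boundary of an
element of a degree in which `Fᵢ₊₁` is zero. -/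
theorem IsMinimalFreeResolution.eq_zero_of_mem_cycles [Nontrivial k]
    (hF : F.IsMinimalFreeResolution J) {i : ℕ} {f : F.B i →₀ MvPolynomial σ k}
    (hf : f ∈ F.cycles i) (hfe : IsHomogeneousElement (F.deg i) (F.initialDegree + i) f) :
    f = 0 := by
  obtain ⟨g, hg, rfl⟩ := hF.exists_homogeneous hf hfe
  have : g = 0 := Finsupp.ext fun b => (hg b).eq_zero_of_lt (by have := hF.le_deg (i + 1) b; omega)
  rw [this, map_zero]

theorem IsMinimalFreeResolution.d_mem_cycles (hF : F.IsMinimalFreeResolution J) (i : ℕ)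
    (b : F.B (i + 1)) : F.d i b ∈ F.cycles i := by
  rw [hF.exact, ← dMap_single]
  exact ⟨_, rfl⟩

/-- A linear minimal free resolution is its own linear strand. -/
theorem IsMinimalFreeResolution.isLinearStrandOf_of_linear [Nontrivial k]
    (hF : F.IsMinimalFreeResolution J) (hlin : ∀ i b, F.deg i b = F.initialDegree + i) :
    F.IsLinearStrandOf J F.initialDegree where
  deg_eq := hlin
  aug_homogeneous := hF.aug_homogeneous
  d_homogeneous := hF.d_homogeneous
  d_mem_cycles := hF.d_mem_cycles
  aug_mem := hF.aug_mem
  aug_surjective _ hp hpd := hF.exists_homogeneous_aug hp hpd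
  aug_injective _ hf h0 := hF.eq_zero_of_mem_cycles (i := 0) h0 hf
  d_surjective _ _ hf hfd := hF.exists_homogeneous hf hfd
  d_injective i _ hg h0 := hF.eq_zero_of_mem_cycles (i := i + 1) h0 hg

/-- The linear strand of a minimal graded free resolution is a subcomplex: degrees leave no room
for other entries of the differential. -/
def IsMinimalFreeResolution.strandInclusion [Nontrivial k] (hF : F.IsMinimalFreeResolution J) :
    F.linearStrand.BasisInclusion F where
  toFun i b := b.1
  injective i := Subtype.val_injective
  deg_eq i b := rfl
  aug_eq b := rfl
  d_eq i b := by
    refine Finsupp.ext fun c => ?_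
    by_cases hc : F.deg i c = F.initialDegree + i
    · exact (Finsupp.mapDomain_apply Subtype.val_injective (F.linearStrand.d i b) ⟨c, hc⟩).symm
    · refine Eq.trans ?_ (Finsupp.mapDomain_of_notMem_range (F.linearStrand.d i b) c
        (by rintro ⟨c', rfl⟩; exact hc c'.2)).symm
      have h1 := hF.d_homogeneous i b.1 c
      have h2 := hF.le_deg i c
      have h3 := b.2
      rcases (show F.deg (i + 1) b.1 < F.deg i c ∨ F.deg (i + 1) b.1 = F.deg i c by omega)
        with h | h
      · exact h1.eq_zero_of_lt h
      · rw [h] at h1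
        rw [h1.eq_C, hF.minimal, map_zero]

/-- The elements of `Fᵢ` of degree `d + i`, `d` the initial degree, belong to the linear strand. -/
theorem IsMinimalFreeResolution.exists_strandInclusion_eq [Nontrivial k]
    (hF : F.IsMinimalFreeResolution J) (i : ℕ) {g : F.B i →₀ MvPolynomial σ k}
    (hg : IsHomogeneousElement (F.deg i) (F.initialDegree + i) g) :
    ∃ f, hF.strandInclusion.map i f = g :=
  hF.strandInclusion.exists_map_eq i g fun b hb => ⟨⟨b, le_antisymm
    (le_of_not_gt fun h => hb ((hg b).eq_zero_of_lt h)) (hF.le_deg i b)⟩, rfl⟩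

theorem IsMinimalFreeResolution.isLinearStrandOf [Nontrivial k]
    (hF : F.IsMinimalFreeResolution J) :
    F.linearStrand.IsLinearStrandOf J F.initialDegree where
  deg_eq i b := b.2
  aug_homogeneous b := hF.aug_homogeneous b.1
  d_homogeneous i b c := hF.d_homogeneous i b.1 c.1
  d_mem_cycles i b := hF.strandInclusion.d_mem_cycles (hF.d_mem_cycles i _)
  aug_mem b := hF.aug_mem b.1
  aug_surjective p hp hpd := by
    obtain ⟨g, hg, rfl⟩ := hF.exists_homogeneous_aug hp hpd
    obtain ⟨f, rfl⟩ := hF.exists_strandInclusion_eq 0 hg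
    exact ⟨f, (hF.strandInclusion.isHomogeneousElement_iff _ _ _).1 hg,
      (hF.strandInclusion.augMap_map f).symm⟩
  aug_injective f hf h0 := hF.strandInclusion.map_injective 0 <| by
    rw [map_zero]
    refine hF.eq_zero_of_mem_cycles (i := 0) ?_
      ((hF.strandInclusion.isHomogeneousElement_iff _ _ _).2 hf)
    rwa [hF.strandInclusion.mem_cycles_iff]
  d_surjective i f hf hfd := by
    obtain ⟨g, hg, hgf⟩ := hF.exists_homogeneous ((hF.strandInclusion.mem_cycles_iff i f).2 hf)
      ((hF.strandInclusion.isHomogeneousElement_iff _ _ _).2 hfd)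
    obtain ⟨g', rfl⟩ := hF.exists_strandInclusion_eq (i + 1) hg
    rw [hF.strandInclusion.dMap_map] at hgf
    exact ⟨g', (hF.strandInclusion.isHomogeneousElement_iff _ _ _).1 hg,
      hF.strandInclusion.map_injective i hgf⟩
  d_injective i g hg h0 := hF.strandInclusion.map_injective (i + 1) <| by
    rw [map_zero]
    refine hF.eq_zero_of_mem_cycles (i := i + 1) ?_
      ((hF.strandInclusion.isHomogeneousElement_iff _ _ _).2 hg)
    rwa [hF.strandInclusion.mem_cycles_iff]

end Resolution

section Uniqueness

variable {σ : Type u} {k : Type v} [CommRing k]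

/-- Two homogeneous maps from graded free modules with all basis elements in degree `e` that are
injective in degree `e`, and with the same image there, differ by a homogeneous isomorphism. -/
theorem exists_equiv_of_same_image {M : Type*} [AddCommGroup M] [Module (MvPolynomial σ k) M]
    {B : Type w} {B' : Type w'} {deg : B → ℕ} {deg' : B' → ℕ} {e : ℕ} (hdeg : ∀ b, deg b = e)
    (hdeg' : ∀ b, deg' b = e) (φ : (B →₀ MvPolynomial σ k) →ₗ[MvPolynomial σ k] M)
    (φ' : (B' →₀ MvPolynomial σ k) →ₗ[MvPolynomial σ k] M)
    (hφ : ∀ f, IsHomogeneousElement deg e f → φ f = 0 → f = 0)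
    (hφ' : ∀ f, IsHomogeneousElement deg' e f → φ' f = 0 → f = 0)
    (h : ∀ b, ∃ g, IsHomogeneousElement deg' e g ∧ φ' g = φ (Finsupp.single b 1))
    (h' : ∀ b, ∃ g, IsHomogeneousElement deg e g ∧ φ g = φ' (Finsupp.single b 1)) :
    ∃ ψ : (B →₀ MvPolynomial σ k) ≃ₗ[MvPolynomial σ k] (B' →₀ MvPolynomial σ k),
      IsHomogeneousMap deg deg' ψ.toLinearMap ∧ ∀ f, φ' (ψ f) = φ f := by
  choose g hg hgφ using h
  choose g' hg' hgφ' using h'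
  let α := Finsupp.linearCombination (MvPolynomial σ k) g
  let β := Finsupp.linearCombination (MvPolynomial σ k) g'
  have hα1 : ∀ b, α (Finsupp.single b 1) = g b := fun b => by simp [α]
  have hβ1 : ∀ b, β (Finsupp.single b 1) = g' b := fun b => by simp [β]
  have hα : IsHomogeneousMap deg deg' α := fun b => by rw [hα1, hdeg]; exact hg b
  have hβ : IsHomogeneousMap deg' deg β := fun b => by rw [hβ1, hdeg']; exact hg' b
  have hα' : φ' ∘ₗ α = φ := by
    ext b
    simp only [LinearMap.comp_apply, Finsupp.lsingle_apply, hα1, hgφ]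
  have hβ' : φ ∘ₗ β = φ' := by
    ext b
    simp only [LinearMap.comp_apply, Finsupp.lsingle_apply, hβ1, hgφ']
  have h1 : ∀ b, IsHomogeneousElement deg e (Finsupp.single b (1 : MvPolynomial σ k)) := fun b => by
    simpa using IsHomogeneousElement.single (σ := σ) deg (hdeg b) (1 : k)
  have h1' : ∀ b, IsHomogeneousElement deg' e (Finsupp.single b (1 : MvPolynomial σ k)) :=
    fun b => by simpa using IsHomogeneousElement.single (σ := σ) deg' (hdeg' b) (1 : k)
  refine ⟨LinearEquiv.ofLinearMap α β ?_ ?_, hα, fun f => LinearMap.congr_fun hα' f⟩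
  · ext1 b
    ext1
    simp only [LinearMap.comp_apply, Finsupp.lsingle_apply, LinearMap.id_apply]
    refine sub_eq_zero.1 (hφ' _ ((hα.map_isHomogeneousElement
      (hβ.map_isHomogeneousElement (h1' b))).sub (h1' b)) ?_)
    rw [map_sub, ← LinearMap.comp_apply, hα', ← LinearMap.comp_apply, hβ', sub_self]
  · ext1 b
    ext1
    simp only [LinearMap.comp_apply, Finsupp.lsingle_apply, LinearMap.id_apply]
    refine sub_eq_zero.1 (hφ _ ((hβ.map_isHomogeneousElement
      (hα.map_isHomogeneousElement (h1 b))).sub (h1 b)) ?_)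
    rw [map_sub, ← LinearMap.comp_apply, hβ', ← LinearMap.comp_apply, hα', sub_self]

/-- Linear strands are unique up to isomorphism. -/
theorem IsLinearStrandOf.nonempty_gradedIso {C : FreeSequence.{u, v, w} σ k}
    {G : FreeSequence.{u, v, w'} σ k} {J : Ideal (MvPolynomial σ k)} {d : ℕ}
    (hC : C.IsLinearStrandOf J d) (hG : G.IsLinearStrandOf J d) : Nonempty (C.GradedIso G) := by
  -- The isomorphisms in homological degree `i` from which the construction continues.
  let S : ℕ → Type _ := fun i =>
    {φ : (C.B i →₀ MvPolynomial σ k) ≃ₗ[MvPolynomial σ k] (G.B i →₀ MvPolynomial σ k) //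
      IsHomogeneousMap (C.deg i) (G.deg i) φ.toLinearMap ∧
        ∀ f, φ f ∈ G.cycles i ↔ f ∈ C.cycles i}
  have h0 : ∃ φ : S 0, ∀ f, G.augMap (φ.1 f) = C.augMap f := by
    obtain ⟨φ, hφ, hc⟩ := exists_equiv_of_same_image (e := d) (hC.deg_eq 0) (hG.deg_eq 0) C.augMap
      G.augMap hC.aug_injective hG.aug_injective
      (fun b => by
        rw [augMap_single]
        exact hG.aug_surjective _ (hC.aug_mem b) (by simpa [hC.deg_eq] using hC.aug_homogeneous b))
      (fun b => by
        rw [augMap_single]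
        exact hC.aug_surjective _ (hG.aug_mem b) (by simpa [hG.deg_eq] using hG.aug_homogeneous b))
    exact ⟨⟨φ, hφ, fun f => by simp only [cycles, LinearMap.mem_ker, hc]⟩, hc⟩
  have hstep : ∀ i (φ : S i), ∃ ψ : S (i + 1), ∀ f, φ.1 (C.dMap i f) = G.dMap i (ψ.1 f) := by
    rintro i ⟨φ, hφ, hφc⟩
    have hφ' := hφ.symm
    have hCd := dMap_isHomogeneousMap hC.d_homogeneous i
    obtain ⟨ψ, hψ, hc⟩ := exists_equiv_of_same_image (e := d + (i + 1)) (hC.deg_eq (i + 1))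
      (hG.deg_eq (i + 1)) (φ.toLinearMap ∘ₗ C.dMap i) (G.dMap i)
      (fun f hf h => hC.d_injective i f hf (φ.map_eq_zero_iff.1 h)) (hG.d_injective i)
      (fun b => by
        rw [LinearMap.comp_apply, dMap_single]
        refine hG.d_surjective i _ ((hφc _).2 (hC.d_mem_cycles i b))
          (hφ.map_isHomogeneousElement fun c => ?_)
        rw [← hC.deg_eq (i + 1) b]
        exact hC.d_homogeneous i b c)
      (fun b => by
        rw [dMap_single]
        have hb : φ (φ.symm (G.d i b)) = G.d i b := φ.apply_symm_apply _
        obtain ⟨g, hg, hgb⟩ := hC.d_surjective i (φ.symm (G.d i b))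
          ((hφc _).1 (hb.symm ▸ hG.d_mem_cycles i b)) (hφ'.map_isHomogeneousElement fun c => by
            rw [← hG.deg_eq (i + 1) b]
            exact hG.d_homogeneous i b c)
        exact ⟨g, hg, by rw [LinearMap.comp_apply, hgb]; exact hb⟩)
    refine ⟨⟨ψ, hψ, fun f => ?_⟩, fun f => (hc f).symm⟩
    simp only [cycles, LinearMap.mem_ker, hc]
    exact φ.map_eq_zero_iff
  obtain ⟨φ₀, hφ₀⟩ := h0
  choose next hnext using hstep
  let φ : ∀ i, S i := fun i => Nat.rec φ₀ next i
  exact ⟨⟨fun i => (φ i).1, fun i => (φ i).2.1, fun i f => hnext i (φ i) f, hφ₀⟩⟩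

/-- A linear strand that is isomorphic to a minimal graded free resolution is one itself. -/
theorem IsLinearStrandOf.isMinimalFreeResolution {C : FreeSequence.{u, v, w} σ k}
    {G : FreeSequence.{u, v, w'} σ k} {J : Ideal (MvPolynomial σ k)} {d : ℕ}
    (hC : C.IsLinearStrandOf J d) (hfin : ∀ i, Finite (C.B i)) (φ : C.GradedIso G)
    (hG : G.IsMinimalFreeResolution J) : C.IsMinimalFreeResolution J := by
  have hexact : ∀ i, C.cycles i = LinearMap.range (C.dMap i) := by
    intro i
    refine le_antisymm (fun f hf => ?_) ?_
    · have := (φ.mem_cycles_iff i f).2 hf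
      rw [hG.exact] at this
      obtain ⟨g, hg⟩ := this
      refine ⟨(φ.equiv (i + 1)).symm g, (φ.equiv i).injective ?_⟩
      rw [φ.comm_d, LinearEquiv.apply_symm_apply, hg]
    · rintro _ ⟨g, rfl⟩
      exact C.dMap_mem_cycles hC.d_mem_cycles i g
  refine ⟨hfin, hC.aug_homogeneous, hC.d_homogeneous, ?_, hexact 0, fun i => hexact (i + 1), ?_⟩
  · rw [← hG.range_aug]
    ext p
    constructor
    · rintro ⟨f, rfl⟩
      exact ⟨_, φ.comm_aug f⟩
    · rintro ⟨f, rfl⟩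
      exact ⟨(φ.equiv 0).symm f, by rw [← φ.comm_aug, LinearEquiv.apply_symm_apply]⟩
  · intro i b c
    refine (hC.d_homogeneous i b c).constantCoeff_eq_zero ?_
    rw [hC.deg_eq, hC.deg_eq]
    omega

end Uniqueness

end FreeSequence

/-! ### Faces of linear cell complexes -/

section Combinatorics

variable {σ : Type u} {P : Type w} [PartialOrder P] [OrderBot P]

/-- The combinatorial properties of a labelled regular CW complex whose cellular complex is a
linear strand: `m` are the multidegrees, `ht x` is the dimension of `x` plus one, and
`ε` is an incidence function. By `degree_eq` the degrees grow by one with the dimension; `injective`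
holds as the differential is injective in the lowest degree; `connected` says that the boundary of
a face of dimension at least `2` is connected. -/
structure LinearLabelling (m : P → σ →₀ ℕ) (ht : P → ℕ) (ε : P → P → ℤ) (d : ℕ) : Prop where
  mono : Monotone m
  ht_strictMono : StrictMono ht
  ht_bot : ht ⊥ = 0
  exists_facet : ∀ x, x ≠ ⊥ → ∃ y, y ⋖ x ∧ ht y + 1 = ht x
  degree_eq : ∀ x, x ≠ ⊥ → (m x).degree + 1 = d + ht x
  incidence : IsIncidenceFunction ε
  edge : ∀ x y, ht x = 2 → ht y = 2 → m x = m y → x = y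
  injective : ∀ x y (c : ℤ), 2 ≤ ht x → ht y = ht x → m x = m y → (c = 1 ∨ c = -1) →
    (∀ s, ht s + 1 = ht x → ε x s = c * ε y s) → x = y
  connected : ∀ x, 3 ≤ ht x → ∀ p : P → Prop,
    (∀ y z, ⊥ < y → y ≤ z → z < x → (p y ↔ p z)) →
      ∀ y z, ⊥ < y → y < x → ⊥ < z → z < x → p y → p z

namespace LinearLabelling

variable {m : P → σ →₀ ℕ} {ht : P → ℕ} {ε : P → P → ℤ} {d : ℕ}

theorem ht_pos (h : LinearLabelling m ht ε d) {x : P} (hx : x ≠ ⊥) : 0 < ht x := by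
  have := h.ht_strictMono (bot_lt_iff_ne_bot.2 hx)
  omega

/-- The multidegree of a face is that of a facet times a variable. -/
theorem exists_label (h : LinearLabelling m ht ε d) {x y : P} (hx : x ≠ ⊥) (hxy : x ≤ y)
    (hht : ht y = ht x + 1) : ∃ a, m y = m x + Finsupp.single a 1 := by
  obtain ⟨t, ht'⟩ := exists_add_of_le (h.mono hxy)
  have h1 := h.degree_eq x hx
  have h2 := h.degree_eq y (fun h0 => hx (le_bot_iff.1 (h0 ▸ hxy)))
  rw [ht', map_add] at h2
  obtain ⟨a, rfl⟩ := (Finsupp.sum_eq_one_iff t).1 (show t.degree = 1 by omega)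
  exact ⟨a, ht'⟩

theorem label_eq {t : σ →₀ ℕ} {a b c : σ} (hab : a ≠ b)
    (h : t + Finsupp.single a 1 ≤ t + Finsupp.single b 1 + Finsupp.single c 1) : a = c := by
  classical
  by_contra hc
  have := h a
  simp [Ne.symm hab, Ne.symm hc] at this

/-- Faces with a common facet are determined by their multidegree, in dimension less than `n`. -/
def UniqueBelow (m : P → σ →₀ ℕ) (ht : P → ℕ) (n : ℕ) : Prop :=
  ∀ x y s, 2 ≤ ht x → ht x ≤ n → ht y = ht x → s ⋖ x → s ⋖ y → m x = m y → x = y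

/-- Facets have codimension one, for the faces of dimension less than `n`. -/
def GradedBelow (ht : P → ℕ) (n : ℕ) : Prop :=
  ∀ x y, y ⋖ x → ht x ≤ n → ht x = ht y + 1

/-- The signs of an incidence function cannot cancel over a single face. -/
theorem exists_ne_of_covBy (h : LinearLabelling m ht ε d) {x y z : P} (hxy : x ⋖ y) (hyz : y ⋖ z) :
    ∃ y', y' ≠ y ∧ x ⋖ y' ∧ y' ⋖ z := by
  by_contra! hcon
  have h0 := h.incidence.cancel z x
  rw [finsum_eq_single _ y] at h0
  · exact mul_ne_zero ((h.incidence.ne_zero_iff _ _).2 hyz) ((h.incidence.ne_zero_iff _ _).2 hxy) h0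
  · intro y' hy'
    by_contra hne
    exact hcon y' hy' ((h.incidence.ne_zero_iff _ _).1 (right_ne_zero_of_mul hne))
      ((h.incidence.ne_zero_iff _ _).1 (left_ne_zero_of_mul hne))

/-- In an interval `[x, z]` of length two, the variables `a` and `b` by which the multidegree
grows along a maximal chain are distinct, and there is a chain with the variables in the opposite
order. -/
theorem exists_swap (h : LinearLabelling m ht ε d) {n : ℕ} (hU : UniqueBelow m ht n) {x y z : P}
    (hx : x ≠ ⊥) (hxy : x ⋖ y) (hyz : y ⋖ z) (hhy : ht y = ht x + 1) (hhz : ht z = ht y + 1)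
    (hn : ht y ≤ n) {a b : σ} (ha : m y = m x + Finsupp.single a 1)
    (hb : m z = m y + Finsupp.single b 1) :
    b ≠ a ∧ ∃ y', x ⋖ y' ∧ y' ⋖ z ∧ ht y' = ht x + 1 ∧ m y' = m x + Finsupp.single b 1 := by
  obtain ⟨y', hne, hxy', hyz'⟩ := h.exists_ne_of_covBy hxy hyz
  have h1 := h.ht_strictMono hxy'.lt
  have h2 := h.ht_strictMono hyz'.lt
  have h3 := h.ht_pos hx
  have hhy' : ht y' = ht x + 1 := by omega
  obtain ⟨c, hc⟩ := h.exists_label hx hxy'.le hhy'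
  have hca : c ≠ a := by
    rintro rfl
    exact hne (hU y' y x (by omega) (by omega) (by omega) hxy' hxy (hc.trans ha.symm))
  have hcb : c = b := by
    refine label_eq hca (t := m x) ?_
    rw [← hc, ← ha, ← hb]
    exact h.mono hyz'.le
  subst hcb
  exact ⟨hca, y', hxy', hyz', hhy', hc⟩

/-- The two faces between `t` and `q` contribute opposite signs. -/
theorem incidence_swap (h : LinearLabelling m ht ε d) {n : ℕ} (hU : UniqueBelow m ht n)
    {q s s' t : P} (hht : ht q = ht t + 2) (hn : ht t < n) (ht0 : t ≠ ⊥) (hts : t ⋖ s) (hsq : s ⋖ q)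
    (hts' : t ⋖ s') (hsq' : s' ⋖ q) (hne : s ≠ s') :
    ε q s * ε s t + ε q s' * ε s' t = 0 := by
  classical
  have ht1 := h.ht_pos ht0
  have hhs : ∀ r, t ⋖ r → r ⋖ q → ht r = ht t + 1 := by
    intro r h1 h2
    have h3 := h.ht_strictMono h1.lt
    have h4 := h.ht_strictMono h2.lt
    omega
  have hsum := h.incidence.cancel q t
  rw [finsum_eq_sum_of_support_subset (s := {s, s'}), Finset.sum_pair hne] at hsum
  · exact hsum
  intro r hr
  have hrq := (h.incidence.ne_zero_iff _ _).1 (left_ne_zero_of_mul hr)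
  have htr := (h.incidence.ne_zero_iff _ _).1 (right_ne_zero_of_mul hr)
  have e := hhs s hts hsq
  have e' := hhs s' hts' hsq'
  have er := hhs r htr hrq
  obtain ⟨a, ha⟩ := h.exists_label ht0 hts.le e
  obtain ⟨a', ha'⟩ := h.exists_label ht0 hts'.le e'
  obtain ⟨c, hc⟩ := h.exists_label ht0 htr.le er
  have hs0 : s ≠ ⊥ := (bot_le.trans_lt hts.lt).ne'
  obtain ⟨b, hb⟩ := h.exists_label hs0 hsq.le (by omega)
  have key : ∀ r c, t ⋖ r → r ⋖ q → m r = m t + Finsupp.single c 1 → c ≠ a → c = b := by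
    intro r c h1 h2 h3 h4
    refine label_eq h4 (t := m t) ?_
    rw [← h3, ← ha, ← hb]
    exact h.mono h2.le
  have huniq : ∀ r r', t ⋖ r → r ⋖ q → t ⋖ r' → r' ⋖ q → m r = m r' → r = r' := by
    intro r r' h1 h2 h3 h4 h5
    have := hhs r h1 h2
    have := hhs r' h3 h4
    exact hU r r' t (by omega) (by omega) (by omega) h1 h3 h5
  simp only [Finset.coe_insert, Finset.coe_singleton, Set.mem_insert_iff, Set.mem_singleton_iff]
  by_cases hca : c = a
  · exact Or.inl (huniq r s htr hrq hts hsq (by rw [hc, ha, hca]))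
  · refine Or.inr (huniq r s' htr hrq hts' hsq' ?_)
    have : a' ≠ a := by
      rintro rfl
      exact hne (huniq s s' hts hsq hts' hsq' (ha.trans ha'.symm))
    rw [hc, ha', key r c htr hrq hc hca, key s' a' hts' hsq' ha' this]

section Facets

variable [Finite P]

/-- Let `p` be a property of facets of `q`. If all facets of `q` above `y` have `p`, then each
variable that divides `m q / m y` is the quotient `m z / m y` for some `z` covering `y`. -/
theorem exists_covBy_of_label (h : LinearLabelling m ht ε d) {n : ℕ} (hU : UniqueBelow m ht n)
    (hG : GradedBelow ht n) {q : P} (hq : ht q = n + 1) {p : P → Prop}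
    (hp : ∀ s, p s → ht s + 1 = ht q) {a : σ} (y : P) (hy : y ≠ ⊥) (hyq : y < q)
    (hyp : ∀ s, y ≤ s → s ⋖ q → p s) (ha : m y + Finsupp.single a 1 ≤ m q) :
    ∃ z, y ⋖ z ∧ z ≤ q ∧ ht z = ht y + 1 ∧ m z = m y + Finsupp.single a 1 := by
  induction y using WellFoundedGT.induction with
  | ind y ih =>
  obtain ⟨z, hyz, hzq⟩ := exists_covBy_le_of_lt hyq
  have hht : ht z = ht y + 1 := by
    rcases hzq.lt_or_eq with hlt | rfl
    · have := h.ht_strictMono hlt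
      exact hG z y hyz (by omega)
    · exact (hp y (hyp y le_rfl hyz)).symm
  obtain ⟨b, hb⟩ := h.exists_label hy hyz.le hht
  rcases eq_or_ne a b with rfl | hab
  · exact ⟨z, hyz, hzq, hht, hb⟩
  rcases hzq.lt_or_eq with hlt | rfl
  · have hza : m z + Finsupp.single a 1 ≤ m q := by
      classical
      intro c
      have h1 := h.mono hzq c
      have h2 := ha c
      rw [hb] at h1 ⊢
      simp only [Finsupp.add_apply, Finsupp.single_apply] at h1 h2 ⊢
      split_ifs at h1 h2 ⊢ with h3 h4
      · exact absurd (h4.trans h3.symm) hab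
      all_goals omega
    obtain ⟨w, hzw, hwq, hhw, hw⟩ := ih z hyz.lt (bot_le.trans_lt hyz.lt).ne' hlt
      (fun s hs => hyp s (hyz.le.trans hs)) hza
    have := h.ht_strictMono hlt
    obtain ⟨-, z', hyz', hzw', hhz', hz'⟩ :=
      h.exists_swap hU hy hyz hzw hht hhw (by omega) hb hw
    exact ⟨z', hyz', hzw'.le.trans hwq, hhz', hz'⟩
  · rw [hb] at ha
    refine absurd (label_eq hab (c := b) (ha.trans ?_)) hab
    exact le_self_add

/-- Let `p` be a property of facets of `q` of codimension one, shared by any two facets with a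
common nonempty facet. Then the facets of `q` that contain a given nonempty face all have `p`, or
none of them has. -/
theorem facets_above (h : LinearLabelling m ht ε d) {n : ℕ} (hU : UniqueBelow m ht n)
    (hG : GradedBelow ht n) {q : P} (hq : ht q = n + 1) {p : P → Prop}
    (hp : ∀ s, p s → ht s + 1 = ht q)
    (hadj : ∀ s s' t, p s → s ⋖ q → s' ⋖ q → t ≠ ⊥ → t ⋖ s → t ⋖ s' → p s')
    (x : P) (hx : x ≠ ⊥) (hxq : x < q) :
    (∀ s, x ≤ s → s ⋖ q → p s) ∨ ∀ s, x ≤ s → s ⋖ q → ¬ p s := by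
  induction x using WellFoundedGT.induction with
  | ind x ih =>
  by_contra! hcon
  obtain ⟨⟨s', hxs', hsq', hps'⟩, s, hxs, hsq, hps⟩ := hcon
  have hxlt : ∀ r r', x ≤ r → r ⋖ q → x ≤ r' → r' ⋖ q → r ≠ r' → x < r := by
    intro r r' h1 h2 h3 h4 h5
    refine h1.lt_of_ne ?_
    rintro rfl
    rcases h3.lt_or_eq with h6 | h6
    · exact h2.2 h6 h4.lt
    · exact h5 h6
  have hne : s ≠ s' := by
    rintro rfl
    exact hps' hps
  obtain ⟨y, hxy, hys⟩ := exists_covBy_le_of_lt (hxlt s s' hxs hsq hxs' hsq' hne)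
  obtain ⟨y', hxy', hys'⟩ := exists_covBy_le_of_lt (hxlt s' s hxs' hsq' hxs hsq hne.symm)
  have hyq := hys.trans_lt hsq.lt
  have hyq' := hys'.trans_lt hsq'.lt
  have hy0 : y ≠ ⊥ := (bot_le.trans_lt hxy.lt).ne'
  have hy0' : y' ≠ ⊥ := (bot_le.trans_lt hxy'.lt).ne'
  have hy : ∀ r, y ≤ r → r ⋖ q → p r :=
    (ih y hxy.lt hy0 hyq).resolve_right fun h' => h' s hys hsq hps
  have hy' : ∀ r, y' ≤ r → r ⋖ q → ¬ p r :=
    (ih y' hxy'.lt hy0' hyq').resolve_left fun h' => hps' (h' s' hys' hsq')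
  have hlt := h.ht_strictMono hyq
  have hlt' := h.ht_strictMono hyq'
  have hx1 := h.ht_pos hx
  have hhy := hG y x hxy (by omega)
  have hhy' := hG y' x hxy' (by omega)
  obtain ⟨a, ha⟩ := h.exists_label hx hxy.le hhy
  obtain ⟨a', ha'⟩ := h.exists_label hx hxy'.le hhy'
  have haa : a ≠ a' := by
    rintro rfl
    have := hU y y' x (by omega) (by omega) (by omega) hxy hxy' (ha.trans ha'.symm)
    subst this
    exact hy' s hys hsq hps
  have hle : m y + Finsupp.single a' 1 ≤ m q := by
    classical
    intro c
    have h1 := h.mono hyq.le c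
    have h2 := h.mono hyq'.le c
    rw [ha] at h1 ⊢
    rw [ha'] at h2
    simp only [Finsupp.add_apply, Finsupp.single_apply] at h1 h2 ⊢
    split_ifs at h1 h2 ⊢ with h3 h4
    · exact absurd (h3.trans h4.symm) haa
    all_goals omega
  obtain ⟨z, hyz, hzq, hhz, hz⟩ := h.exists_covBy_of_label hU hG hq hp y hy0 hyq hy hle
  rcases hzq.lt_or_eq with hzlt | rfl
  · obtain ⟨-, w, hxw, hwz, hhw, hw⟩ := h.exists_swap hU hx hxy hyz hhy hhz (by omega) ha hz
    have hwy : w = y' := hU w y' x (by omega) (by omega) (by omega) hxw hxy' (hw.trans ha'.symm)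
    subst hwy
    obtain ⟨r, hzr, hrq⟩ := exists_le_covBy_of_lt hzlt
    exact hy' r (hwz.le.trans hzr) hrq (hy r (hyz.le.trans hzr) hrq)
  · -- Here `y` is a facet, so `y'` has the height of a facet and is one.
    have hs' : y' = s' := by
      by_contra hne'
      have h1 := h.ht_strictMono (hys'.lt_of_ne hne')
      have h2 := h.ht_strictMono hsq'.lt
      omega
    subst hs'
    exact hps' (hadj y y' x (hy y le_rfl hyz) hyz hsq' hx hxy hxy')

/-- The boundary of a face of dimension at least two is strongly connected. -/
theorem facets_connected (h : LinearLabelling m ht ε d) {n : ℕ} (hU : UniqueBelow m ht n)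
    (hG : GradedBelow ht n) (hn : 2 ≤ n) {q : P} (hq : ht q = n + 1) {p : P → Prop}
    (hp : ∀ s, p s → ht s + 1 = ht q)
    (hadj : ∀ s s' t, p s → s ⋖ q → s' ⋖ q → t ≠ ⊥ → t ⋖ s → t ⋖ s' → p s')
    {s : P} (hsq : s ⋖ q) (hs : p s) {s' : P} (hsq' : s' ⋖ q) : p s' := by
  have hq0 : q ≠ ⊥ := (bot_le.trans_lt hsq.lt).ne'
  obtain ⟨r, hrq, hr⟩ := h.exists_facet q hq0
  have hr0 : r ≠ ⊥ := by
    rintro rfl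
    rw [h.ht_bot] at hr
    omega
  have hbot : ∀ t, t ⋖ q → ⊥ < t := by
    intro t ht'
    refine bot_lt_iff_ne_bot.2 ?_
    rintro rfl
    exact ht'.2 (bot_lt_iff_ne_bot.2 hr0) hrq.lt
  refine h.connected q (by omega) (fun x => ∀ r, x ≤ r → r ⋖ q → p r) ?_ s s' (hbot s hsq) hsq.lt
    (hbot s' hsq') hsq'.lt ?_ s' le_rfl hsq'
  · intro y z hy hyz hzq
    refine ⟨fun h' r hzr => h' r (hyz.trans hzr), fun h' => ?_⟩
    obtain ⟨r, hzr, hrq⟩ := exists_le_covBy_of_lt hzq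
    exact (h.facets_above hU hG hq hp hadj y hy.ne' (hyz.trans_lt hzq)).resolve_right
      fun h'' => h'' r (hyz.trans hzr) hrq (h' r hzr hrq)
  · intro r hsr hrq
    rcases hsr.lt_or_eq with hlt | rfl
    · exact absurd hrq.lt (hsq.2 hlt)
    · exact hs

theorem gradedBelow_succ (h : LinearLabelling m ht ε d) {n : ℕ} (hU : UniqueBelow m ht n)
    (hG : GradedBelow ht n) (hn : 2 ≤ n) : GradedBelow ht (n + 1) := by
  intro x y hyx hx
  rcases hx.lt_or_eq with hlt | hx
  · exact hG x y hyx (by omega)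
  obtain ⟨r, hrx, hr⟩ := h.exists_facet x (bot_le.trans_lt hyx.lt).ne'
  refine (h.facets_connected hU hG hn hx (p := fun s => ht s + 1 = ht x) (fun _ => id) ?_
    hrx hr hyx).symm
  intro s s' t hs hsx hsx' _ hts hts'
  have h1 := h.ht_strictMono hsx'.lt
  have h2 := hG s t hts (by omega)
  have h3 := hG s' t hts' (by omega)
  omega

/-- Two faces with the same multidegree and a common facet have the same boundary, up to a sign
`c`: going from a facet to an adjacent one, the multidegrees leave no choice. -/
theorem incidence_eq (h : LinearLabelling m ht ε d) {n : ℕ} (hU : UniqueBelow m ht n)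
    (hG : GradedBelow ht n) (hn : 2 ≤ n) {q q' s₀ : P} (hq : ht q = n + 1) (hq' : ht q' = n + 1)
    (hm : m q = m q') {c : ℤ} (hs : s₀ ⋖ q) (hs' : s₀ ⋖ q')
    (hc : ε q s₀ = c * ε q' s₀) {s : P} (hsq : s ⋖ q) : s ⋖ q' ∧ ε q s = c * ε q' s := by
  have hG' := h.gradedBelow_succ hU hG hn
  refine (h.facets_connected hU hG hn hq
    (p := fun s => ht s + 1 = ht q ∧ s ⋖ q' ∧ ε q s = c * ε q' s) (fun s hs => hs.1) ?_ hs
    ⟨(hG' q s₀ hs hq.le).symm, hs', hc⟩ hsq).2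
  rintro s s' t ⟨hhs, hsq', hεs⟩ hsq hsq₂ ht0 hts hts'
  rcases eq_or_ne s s' with rfl | hne
  · exact ⟨hhs, hsq', hεs⟩
  have hhs₂ := hG' q s' hsq₂ hq.le
  have hht := hG s t hts (by omega)
  have ht1 := h.ht_pos ht0
  have hs0 : s ≠ ⊥ := (bot_le.trans_lt hts.lt).ne'
  obtain ⟨a, ha⟩ := h.exists_label ht0 hts.le hht
  obtain ⟨b, hb⟩ := h.exists_label hs0 hsq.le hhs.symm
  obtain ⟨a', ha'⟩ := h.exists_label ht0 hts'.le (by omega)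
  have haa : a' ≠ a := by
    rintro rfl
    exact hne (hU s s' t (by omega) (by omega) (by omega) hts hts' (ha.trans ha'.symm))
  have hab : a' = b := by
    refine label_eq haa (t := m t) ?_
    rw [← ha', ← ha, ← hb]
    exact h.mono hsq₂.le
  obtain ⟨-, r, htr, hrq, hhr, hr⟩ := h.exists_swap hU ht0 hts hsq' hht (by omega) (by omega) ha
    (hm ▸ hb)
  have hrs : r = s' := hU r s' t (by omega) (by omega) (by omega) htr hts'
    (hr.trans (by rw [ha', hab]))
  subst hrs
  refine ⟨hhs₂.symm, hrq, ?_⟩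
  have e1 := h.incidence_swap hU (by omega) (by omega) ht0 hts hsq hts' hsq₂ hne
  have e2 := h.incidence_swap hU (by omega) (by omega) ht0 hts hsq' hts' hrq hne
  have hne0 := (h.incidence.ne_zero_iff _ _).2 hts'
  refine mul_right_cancel₀ hne0 ?_
  rw [hεs] at e1
  linear_combination e1 - c * e2

theorem uniqueBelow_succ (h : LinearLabelling m ht ε d) {n : ℕ} (hU : UniqueBelow m ht n)
    (hG : GradedBelow ht n) (hn : 2 ≤ n) : UniqueBelow m ht (n + 1) := by
  intro q q' s hq2 hq hqq hs hs' hm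
  rcases hq.lt_or_eq with hlt | hq
  · exact hU q q' s hq2 (by omega) hqq hs hs' hm
  have hε : ∀ x, s ⋖ x → ε x s = 1 ∨ ε x s = -1 := fun x hx =>
    (h.incidence.values x s).resolve_left ((h.incidence.ne_zero_iff _ _).2 hx)
  have hc : ∃ c : ℤ, (c = 1 ∨ c = -1) ∧ ε q s = c * ε q' s ∧ ε q' s = c * ε q s := by
    rcases hε q hs with h1 | h1 <;> rcases hε q' hs' with h2 | h2 <;> rw [h1, h2]
    · exact ⟨1, by simp⟩
    · exact ⟨-1, by simp⟩
    · exact ⟨-1, by simp⟩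
    · exact ⟨1, by simp⟩
  obtain ⟨c, hc1, hc2, hc3⟩ := hc
  refine h.injective q q' c hq2 hqq hm hc1 fun r _ => ?_
  by_cases hrq : r ⋖ q
  · exact (h.incidence_eq hU hG hn hq (by omega) hm hs hs' hc2 hrq).2
  · have hrq' : ¬ r ⋖ q' := fun h' =>
      hrq (h.incidence_eq hU hG hn (by omega) hq hm.symm hs' hs hc3 h').1
    rw [not_not.1 (mt (h.incidence.ne_zero_iff q r).1 hrq),
      not_not.1 (mt (h.incidence.ne_zero_iff q' r).1 hrq'), mul_zero]

theorem uniqueBelow_and_gradedBelow (h : LinearLabelling m ht ε d) (n : ℕ) :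
    UniqueBelow m ht (n + 2) ∧ GradedBelow ht (n + 2) := by
  induction n with
  | zero =>
    refine ⟨fun x y s h1 h2 h3 _ _ hm => h.edge x y (by omega) (by omega) hm,
      fun x y hyx hx => ?_⟩
    have h1 := h.ht_strictMono hyx.lt
    by_contra hne
    obtain ⟨r, hrx, hr⟩ := h.exists_facet x (bot_le.trans_lt hyx.lt).ne'
    have hy : y = ⊥ := by
      by_contra hy
      have := h.ht_pos hy
      omega
    subst hy
    rw [h.ht_bot] at h1 hne
    refine hyx.2 (bot_lt_iff_ne_bot.2 ?_) hrx.lt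
    rintro rfl
    rw [h.ht_bot] at hr
    omega
  | succ n ih =>
    exact ⟨h.uniqueBelow_succ ih.1 ih.2 (by omega), h.gradedBelow_succ ih.1 ih.2 (by omega)⟩

/-- Facets have codimension one. -/
theorem ht_eq_of_covBy (h : LinearLabelling m ht ε d) {x y : P} (hyx : y ⋖ x) :
    ht x = ht y + 1 :=
  (h.uniqueBelow_and_gradedBelow (ht x)).2 x y hyx (by omega)

/-- Faces of dimension at least one with the same multidegree and a common facet coincide. -/
theorem eq_of_common_facet (h : LinearLabelling m ht ε d) {x y s : P} (hx : 2 ≤ ht x)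
    (hxy : ht y = ht x) (hsx : s ⋖ x) (hsy : s ⋖ y) (hm : m x = m y) : x = y :=
  (h.uniqueBelow_and_gradedBelow (ht x)).1 x y s hx (by omega) hxy hsx hsy hm

end Facets

end LinearLabelling

end Combinatorics

/-! ### Connectedness of the boundaries of faces -/

section Connected

variable {Q : Type u} [PartialOrder Q] [Finite Q]

/-- The point of the realization of the order complex that divides the segment from `a` to `b` in
the ratio `t : 1 - t`. -/
def segmentPoint {a b : Q} (hab : a ≤ b) (t : ℝ) (h0 : 0 ≤ t) (h1 : t ≤ 1) :
    OrderComplexRealization Q :=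
  ⟨fun q => Finsupp.single a (1 - t) q + Finsupp.single b t q, by
    classical
    refine ⟨fun q => ?_, ?_, ?_⟩
    · simp only [Finsupp.single_apply]
      split_ifs <;> linarith
    · have := Fintype.ofFinite Q
      rw [finsum_eq_sum_of_fintype, Finset.sum_add_distrib]
      simp [Finsupp.single_apply]
    · have hmem : ∀ q, Finsupp.single a (1 - t) q + Finsupp.single b t q ≠ 0 → q = a ∨ q = b := by
        intro q hq
        by_contra! hne
        exact hq (by simp [hne.1.symm, hne.2.symm])
      intro x hx y hy hxy
      rcases hmem x hx with rfl | rfl <;> rcases hmem y hy with rfl | rfl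
      · exact absurd rfl hxy
      · exact Or.inl hab
      · exact Or.inr hab
      · exact absurd rfl hxy⟩

theorem segmentPoint_apply_right {a b : Q} (hab : a < b) (t : ℝ) (h0 : 0 ≤ t) (h1 : t ≤ 1) :
    (segmentPoint hab.le t h0 h1).1 b = t := by
  classical
  simp [segmentPoint, hab.ne]

/-- If the realization of the order complex is connected, a property of elements that is shared by
comparable elements holds for all elements or for none: the total weight of the elements with the
property is a continuous function with values in `{0, 1}`. -/
theorem forall_of_preconnected [PreconnectedSpace (OrderComplexRealization Q)] {p : Q → Prop}
    (hp : ∀ x y, x ≤ y → (p x ↔ p y)) {y z : Q} (hy : p y) : p z := by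
  classical
  have := Fintype.ofFinite Q
  by_contra hz
  let f : OrderComplexRealization Q → ℝ := fun c => ∑ q, if p q then c.1 q else 0
  have hf : Continuous f := by
    refine continuous_finsetSum _ fun q _ => ?_
    split_ifs
    · exact (continuous_apply q).comp continuous_subtype_val
    · exact continuous_const
  have hval : ∀ c, f c = 0 ∨ f c = 1 := by
    rintro ⟨c, h0, h1, hc⟩
    by_cases h : ∃ x, p x ∧ c x ≠ 0
    · right
      obtain ⟨x, hx, hcx⟩ := h
      rw [finsum_eq_sum_of_fintype] at h1
      refine Eq.trans ?_ h1
      refine Finset.sum_congr rfl fun q _ => ?_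
      by_cases hq : c q = 0
      · simp [hq]
      · rw [if_pos]
        rcases eq_or_ne q x with rfl | hne
        · exact hx
        · rcases hc hq hcx hne with hle | hle
          · exact (hp _ _ hle).2 hx
          · exact (hp _ _ hle).1 hx
    · left
      push Not at h
      refine Finset.sum_eq_zero fun q _ => ?_
      split_ifs with hq
      · exact h q hq
      · rfl
  have hone : ∀ x : Q, f (segmentPoint le_rfl 1 zero_le_one le_rfl (a := x)) =
      if p x then 1 else 0 := by
    intro x
    simp only [f, segmentPoint, sub_self, Finsupp.single_zero, Finsupp.zero_apply, zero_add,
      Finsupp.single_apply]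
    rw [Finset.sum_eq_single x]
    · simp
    · intro q _ hq
      simp [hq.symm]
    · simp
  obtain ⟨c, hc⟩ := mem_range_of_exists_le_of_exists_ge hf (c := 1 / 2)
    ⟨_, (by rw [hone z, if_neg hz]; norm_num)⟩ ⟨_, (by rw [hone y, if_pos hy]; norm_num)⟩
  rcases hval c with h | h <;> rw [hc] at h <;> norm_num at h

/-- If the realization of the order complex is a sphere and some elements are comparable, the
sphere has positive dimension and is connected. -/
theorem preconnectedSpace_of_homeomorph_sphere {a b : Q} (hab : a < b) {n : ℕ}
    (e : OrderComplexRealization Q ≃ₜ Metric.sphere (0 : EuclideanSpace ℝ (Fin n)) 1) :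
    PreconnectedSpace (OrderComplexRealization Q) := by
  have hinj : ∀ s t : ℝ, ∀ (hs0 : 0 ≤ s) (hs1 : s ≤ 1) (ht0 : 0 ≤ t) (ht1 : t ≤ 1),
      e (segmentPoint hab.le s hs0 hs1) = e (segmentPoint hab.le t ht0 ht1) → s = t := by
    intro s t hs0 hs1 ht0 ht1 h
    have := congrArg (fun c => c.1 b) (e.injective h)
    rwa [segmentPoint_apply_right hab, segmentPoint_apply_right hab] at this
  match n with
  | 0 =>
    have h := (e (segmentPoint hab.le 0 le_rfl zero_le_one)).2
    rw [mem_sphere_zero_iff_norm, EuclideanSpace.norm_eq] at h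
    simp at h
  | 1 =>
    -- The sphere `S^0` has two points, too few for a segment.
    have hS : ∀ x : Metric.sphere (0 : EuclideanSpace ℝ (Fin 1)) 1, x.1 0 = 1 ∨ x.1 0 = -1 := by
      intro x
      have h := x.2
      rw [mem_sphere_zero_iff_norm, EuclideanSpace.norm_eq] at h
      simp only [Finset.univ_unique, Fin.default_eq_zero, Finset.sum_singleton] at h
      rw [Real.sqrt_sq (norm_nonneg _), Real.norm_eq_abs] at h
      exact eq_or_eq_neg_of_abs_eq h
    have hS' : ∀ x y : Metric.sphere (0 : EuclideanSpace ℝ (Fin 1)) 1, x.1 0 = y.1 0 → x = y := by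
      intro x y h
      refine Subtype.ext (PiLp.ext fun i => ?_)
      rwa [Subsingleton.elim i 0]
    have key : ∀ u v w : ℝ, (u = 1 ∨ u = -1) → (v = 1 ∨ v = -1) → (w = 1 ∨ w = -1) →
        u ≠ v → u ≠ w → v ≠ w → False := by
      rintro u v w (rfl | rfl) (rfl | rfl) (rfl | rfl) h1 h2 h3 <;> contradiction
    have hne : ∀ s t : ℝ, ∀ (hs0 : 0 ≤ s) (hs1 : s ≤ 1) (ht0 : 0 ≤ t) (ht1 : t ≤ 1), s ≠ t →
        (e (segmentPoint hab.le s hs0 hs1)).1 0 ≠ (e (segmentPoint hab.le t ht0 ht1)).1 0 :=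
      fun s t hs0 hs1 ht0 ht1 hst h => hst (hinj s t hs0 hs1 ht0 ht1 (hS' _ _ h))
    exact (key _ _ _ (hS _) (hS _) (hS _)
      (hne 0 1 le_rfl zero_le_one zero_le_one le_rfl (by norm_num))
      (hne 0 (1 / 2) le_rfl zero_le_one (by norm_num) (by norm_num) (by norm_num))
      (hne 1 (1 / 2) zero_le_one le_rfl (by norm_num) (by norm_num) (by norm_num))).elim
  | n + 2 =>
    have h : IsConnected (Metric.sphere (0 : EuclideanSpace ℝ (Fin (n + 2))) 1) := by
      refine isConnected_sphere ?_ 0 zero_le_one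
      rw [← Module.finrank_eq_rank, finrank_euclideanSpace_fin]
      exact_mod_cast (by omega : 1 < n + 2)
    have := Subtype.preconnectedSpace h.isPreconnected
    exact e.symm.surjective.denseRange.preconnectedSpace e.symm.continuous

/-- The boundary of a face of dimension at least two of a regular CW complex is connected: a
property of proper faces of `x` that incident faces share holds for all of them or for none. -/
theorem IsCWPoset.connected {P : Type u} [PartialOrder P] [OrderBot P] [Finite P]
    (hP : IsCWPoset P) {x a b : P} (ha : ⊥ < a) (hab : a < b) (hb : b < x) {p : P → Prop}
    (hp : ∀ y z, ⊥ < y → y ≤ z → z < x → (p y ↔ p z)) {y z : P} (hy : ⊥ < y) (hyx : y < x)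
    (hz : ⊥ < z) (hzx : z < x) (h : p y) : p z := by
  obtain ⟨n, ⟨e⟩⟩ := hP.2 x (bot_le.trans_lt hb).ne'
  have := preconnectedSpace_of_homeomorph_sphere
    (show (⟨a, ha, hab.trans hb⟩ : Set.Ioo ⊥ x) < ⟨b, ha.trans hab, hb⟩ from hab) e
  exact forall_of_preconnected (Q := Set.Ioo ⊥ x) (p := fun q => p q.1)
    (fun q r hqr => hp q.1 r.1 q.2.1 hqr r.2.2) (y := ⟨y, hy, hyx⟩) (z := ⟨z, hz, hzx⟩) h

end Connected

/-! ### Cellular complexes that are linear strands -/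

section Heights

variable {P : Type w} [PartialOrder P] [Finite P]

/-- The height of an element of a finite poset as a natural number: the dimension of a face plus
one. -/
def faceHeight (x : P) : ℕ := (Order.height x).toNat

theorem height_lt_top (x : P) : Order.height x < ⊤ := by
  have := Fintype.ofFinite P
  exact (Order.height_le (n := (Fintype.card P : ℕ∞)) fun p _ => by
    exact_mod_cast p.length_lt_card.le).trans_lt (ENat.natCast_lt_top _)

theorem coe_faceHeight (x : P) : (faceHeight x : ℕ∞) = Order.height x :=
  ENat.natCast_toNat (height_lt_top x).ne

theorem faceHeight_eq_iff {x : P} {n : ℕ} : faceHeight x = n ↔ Order.height x = n := by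
  rw [← coe_faceHeight, Nat.cast_inj]

theorem faceHeight_strictMono : StrictMono (faceHeight : P → ℕ) := by
  intro x y h
  have := Order.height_strictMono h (height_lt_top x)
  rw [← coe_faceHeight, ← coe_faceHeight] at this
  exact_mod_cast this

theorem faceHeight_cell {i : ℕ} (x : Cell P i) : faceHeight x.1 = i + 1 :=
  faceHeight_eq_iff.2 (by rw [x.2]; push_cast; rfl)

/-- A face of height `i + 1` as a cell of dimension `i`. -/
def cellOfFaceHeight {i : ℕ} (x : P) (h : faceHeight x = i + 1) : Cell P i :=
  ⟨x, by rw [faceHeight_eq_iff.1 h]; push_cast; rfl⟩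

theorem exists_facet_of_ne_bot [OrderBot P] (x : P) (hx : x ≠ ⊥) :
    ∃ y, y ⋖ x ∧ faceHeight y + 1 = faceHeight x := by
  have h1 := faceHeight_strictMono (bot_lt_iff_ne_bot.2 hx)
  obtain ⟨n, hn⟩ : ∃ n, faceHeight x = n + 1 := ⟨faceHeight x - 1, by omega⟩
  have h2 : (n : ℕ∞) < Order.height x := by
    rw [← coe_faceHeight, hn]
    exact_mod_cast n.lt_succ_self
  obtain ⟨y, hyx, hy⟩ := (Order.coe_lt_height_iff (height_lt_top x)).1 h2
  rw [← faceHeight_eq_iff] at hy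
  refine ⟨y, ⟨hyx, fun z hyz hzx => ?_⟩, by omega⟩
  have h3 := faceHeight_strictMono hyz
  have h4 := faceHeight_strictMono hzx
  omega

theorem isAtom_cell [OrderBot P] (x : Cell P 0) : IsAtom x.1 := by
  have h := faceHeight_cell x
  refine ⟨?_, fun y hy => ?_⟩
  · intro h0
    rw [h0, faceHeight_eq_iff, Order.height_bot] at h
    norm_num at h
  · by_contra hy0
    have h1 := faceHeight_strictMono hy
    have h2 := faceHeight_strictMono (bot_lt_iff_ne_bot.2 hy0)
    omega

end Heights

section Multidegree

variable {σ : Type u} {P : Type w} [PartialOrder P] [OrderBot P] [Finite P]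

theorem label_le_multidegree (label : Vertex P → σ →₀ ℕ) {v : Vertex P} {x : P} (h : v.1 ≤ x) :
    label v ≤ multidegree label x :=
  Finset.le_sup (f := label) (by simpa using h)

theorem multidegree_le (label : Vertex P → σ →₀ ℕ) {x : P} {s : σ →₀ ℕ}
    (h : ∀ v : Vertex P, v.1 ≤ x → label v ≤ s) : multidegree label x ≤ s :=
  Finset.sup_le fun v hv => h v (by simpa using hv)

theorem multidegree_mono (label : Vertex P → σ →₀ ℕ) : Monotone (multidegree label) :=
  fun _ _ hxy => multidegree_le label fun _ hv => label_le_multidegree label (hv.trans hxy)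

theorem multidegree_vertex (label : Vertex P → σ →₀ ℕ) (v : Vertex P) :
    multidegree label v.1 = label v := by
  refine le_antisymm (multidegree_le label fun u hu => ?_) (label_le_multidegree label le_rfl)
  have : u = v := Subtype.ext ((v.2.le_iff_eq u.2.1).1 hu)
  rw [this]

end Multidegree

theorem IsIncidenceFunction.le_of_ne_zero {P : Type w} [PartialOrder P] [OrderBot P]
    {ε : P → P → ℤ} (hε : IsIncidenceFunction ε) {x y : P} (h : ε x y ≠ 0) : y ≤ x :=
  ((hε.ne_zero_iff x y).1 h).le

section Cellular

variable {σ : Type u} {P : Type w} [PartialOrder P] [OrderBot P] [Finite P] {k : Type v}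
  {label : Vertex P → σ →₀ ℕ} {ε : P → P → ℤ}

theorem isHomogeneousEntry_monomial [CommRing k] {s : σ →₀ ℕ} {r : k} {a b : ℕ}
    (h : r ≠ 0 → s.degree + b = a) : IsHomogeneousEntry (MvPolynomial.monomial s r) a b := by
  classical
  rw [isHomogeneousEntry_iff]
  intro t ht
  rw [MvPolynomial.coeff_monomial] at ht
  split_ifs at ht with hst
  · exact hst ▸ h ht
  · exact absurd rfl ht

theorem cellularComplex_aug_homogeneous [CommRing k] (label : Vertex P → σ →₀ ℕ) (ε : P → P → ℤ)
    (x : Cell P 0) : IsHomogeneousEntry ((cellularComplex k label ε).aug x)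
      ((cellularComplex k label ε).deg 0 x) 0 :=
  isHomogeneousEntry_monomial fun _ => rfl

theorem cellularComplex_d_homogeneous [CommRing k] (label : Vertex P → σ →₀ ℕ)
    (hε : IsIncidenceFunction ε) (i : ℕ) (x : Cell P (i + 1)) (y : Cell P i) :
    IsHomogeneousEntry ((cellularComplex k label ε).d i x y)
      ((cellularComplex k label ε).deg (i + 1) x) ((cellularComplex k label ε).deg i y) := by
  refine isHomogeneousEntry_monomial fun h => ?_
  have hyx : y.1 ≤ x.1 := hε.le_of_ne_zero fun h0 => h (by rw [h0, Int.cast_zero])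
  change (multidegree label x.1 - multidegree label y.1).degree +
    (multidegree label y.1).degree = (multidegree label x.1).degree
  rw [← map_add, tsub_add_cancel_of_le (multidegree_mono label hyx)]

/-- A cellular complex that is a linear strand comes from a linear labelling. -/
theorem linearLabelling_of_isLinearStrandOf [CommRing k] [Nontrivial k] (hP : IsCWPoset P)
    (hε : IsIncidenceFunction ε) {I : Ideal (MvPolynomial σ k)} {d : ℕ}
    (hC : (cellularComplex k label ε).IsLinearStrandOf I d)
    (hedge : ∀ x y : Cell P 1, multidegree label x.1 = multidegree label y.1 → x = y) :
    LinearLabelling (multidegree label) faceHeight ε d where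
  mono := multidegree_mono label
  ht_strictMono := faceHeight_strictMono
  ht_bot := faceHeight_eq_iff.2 (by simp)
  exists_facet := exists_facet_of_ne_bot
  degree_eq x hx := by
    obtain ⟨y, -, hy⟩ := exists_facet_of_ne_bot x hx
    have := hC.deg_eq (faceHeight y) (cellOfFaceHeight x hy.symm)
    change (multidegree label x).degree = _ at this
    omega
  incidence := hε
  edge x y hx hy h := congrArg Subtype.val
    (hedge (cellOfFaceHeight x hx) (cellOfFaceHeight y hy) h)
  injective x y c hx hxy hm _ hs := by
    classical
    obtain ⟨i, hi⟩ : ∃ i, faceHeight x = i + 1 + 1 := ⟨faceHeight x - 2, by omega⟩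
    by_contra hne
    let B := (cellularComplex k label ε).B (i + 1)
    let x' : B := cellOfFaceHeight x hi
    let y' : B := cellOfFaceHeight y (hxy.trans hi)
    have hne' : y' ≠ x' := fun h => hne (congrArg Subtype.val h).symm
    let f : B →₀ MvPolynomial σ k := Finsupp.single x' (MvPolynomial.C 1) -
      Finsupp.single y' (MvPolynomial.C (c : k))
    have hf : f = 0 := by
      refine hC.d_injective i f (.sub (.single _ (hC.deg_eq _ _) _)
        (.single _ (hC.deg_eq _ _) _)) ?_
      rw [map_sub, FreeSequence.dMap, Finsupp.linearCombination_single,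
        Finsupp.linearCombination_single, map_one, one_smul]
      refine Finsupp.ext fun s => ?_
      have hε' : ε x s.1 = c * ε y s.1 := hs s.1 (by rw [faceHeight_cell s, hi])
      change MvPolynomial.monomial (multidegree label x - multidegree label s.1)
        ((ε x s.1 : ℤ) : k) - MvPolynomial.C (c : k) *
        MvPolynomial.monomial (multidegree label y - multidegree label s.1)
        ((ε y s.1 : ℤ) : k) = 0
      rw [hε', hm, MvPolynomial.C_mul_monomial]
      push_cast
      exact sub_self _
    have := congrArg (fun p : B →₀ MvPolynomial σ k => p x') hf
    simp [f, hne'] at this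
  connected x hx p hp y z hy hyx hz hzx h := by
    have hx0 : x ≠ ⊥ := (bot_le.trans_lt hyx).ne'
    obtain ⟨b, hbx, hb⟩ := exists_facet_of_ne_bot x hx0
    have hbot : faceHeight (⊥ : P) = 0 := faceHeight_eq_iff.2 (by simp)
    have hb0 : b ≠ ⊥ := by
      rintro rfl
      omega
    obtain ⟨a, hab, ha⟩ := exists_facet_of_ne_bot b hb0
    have ha0 : a ≠ ⊥ := by
      rintro rfl
      omega
    exact hP.connected (bot_lt_iff_ne_bot.2 ha0) hab.lt hbx.lt hp hy hyx hz hzx h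

end Cellular

/-! ### Induced subcomplexes -/

section Induced

variable {P : Type w} [PartialOrder P] [OrderBot P] {X : Set (Vertex P)}

/-- A face of a face of the induced subcomplex belongs to the induced subcomplex. -/
def InducedSubcomplex.ofLE (x : InducedSubcomplex X) (y : P) (h : y ≤ x.1) :
    InducedSubcomplex X :=
  ⟨y, fun v hv => x.2 v (hv.trans h)⟩

theorem InducedSubcomplex.height_val (x : InducedSubcomplex X) :
    Order.height x.1 = Order.height x :=
  (Order.height_eq_of_strictMono (fun x : InducedSubcomplex X => x.1) (fun _ _ h => h)
    (fun x y h => ⟨x.ofLE y h.le, h, rfl⟩) x).symm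

theorem InducedSubcomplex.covBy_val_iff {x y : InducedSubcomplex X} : y.1 ⋖ x.1 ↔ y ⋖ x :=
  ⟨fun h => ⟨h.1, fun z hyz hzx => h.2 (c := z.1) hyz hzx⟩,
    fun h => ⟨h.1, fun z hyz hzx => h.2 (c := x.ofLE z hzx.le) hyz hzx⟩⟩

/-- Isomorphic posets have homeomorphic order complexes. -/
def OrderComplexRealization.congr {Q : Type u} {Q' : Type v} [PartialOrder Q] [PartialOrder Q']
    (e : Q ≃o Q') : OrderComplexRealization Q ≃ₜ OrderComplexRealization Q' where
  toFun c := ⟨fun q => c.1 (e.symm q), fun q => c.2.1 _,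
    (finsum_comp_equiv e.symm.toEquiv (f := c.1)).trans c.2.2.1, fun x hx y hy hxy => by
      simpa using c.2.2.2 (x := e.symm x) hx (y := e.symm y) hy (by simpa using hxy)⟩
  invFun c := ⟨fun q => c.1 (e q), fun q => c.2.1 _,
    (finsum_comp_equiv e.toEquiv (f := c.1)).trans c.2.2.1, fun x hx y hy hxy => by
      simpa using c.2.2.2 (x := e x) hx (y := e y) hy (by simpa using hxy)⟩
  left_inv c := Subtype.ext (funext fun q => congrArg c.1 (e.symm_apply_apply q))
  right_inv c := Subtype.ext (funext fun q => congrArg c.1 (e.apply_symm_apply q))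
  continuous_toFun := (continuous_pi fun q =>
    (continuous_apply (e.symm q)).comp (continuous_subtype_val (p := fun c : Q → ℝ =>
      (∀ q, 0 ≤ c q) ∧ ∑ᶠ q, c q = 1 ∧ IsChain (· ≤ ·) {q | c q ≠ 0}))).subtype_mk _
  continuous_invFun := (continuous_pi fun q =>
    (continuous_apply (e q)).comp (continuous_subtype_val (p := fun c : Q' → ℝ =>
      (∀ q, 0 ≤ c q) ∧ ∑ᶠ q, c q = 1 ∧ IsChain (· ≤ ·) {q | c q ≠ 0}))).subtype_mk _

/-- The open interval below a face is the same in the induced subcomplex. -/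
def InducedSubcomplex.iooOrderIso (x : InducedSubcomplex X) :
    Set.Ioo (⊥ : P) x.1 ≃o Set.Ioo (⊥ : InducedSubcomplex X) x where
  toFun y := ⟨x.ofLE y.1 y.2.2.le, y.2.1, y.2.2⟩
  invFun y := ⟨y.1.1, y.2.1, y.2.2⟩
  left_inv _ := rfl
  right_inv _ := rfl
  map_rel_iff' := Iff.rfl

theorem IsCWPoset.inducedSubcomplex (hP : IsCWPoset P) (hX : X.Nonempty) :
    IsCWPoset (InducedSubcomplex X) := by
  constructor
  · obtain ⟨v, hv⟩ := hX
    refine ⟨⟨v.1, fun u hu => ?_⟩, ⊥, fun h => v.2.1 (congrArg Subtype.val h)⟩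
    rwa [show u = v from Subtype.ext ((v.2.le_iff_eq u.2.1).1 hu)]
  · intro x hx
    obtain ⟨n, ⟨e⟩⟩ := hP.2 x.1 fun h => hx (Subtype.ext h)
    exact ⟨n, ⟨(OrderComplexRealization.congr x.iooOrderIso.symm).trans e⟩⟩

/-- The restriction of an incidence function to an induced subcomplex. -/
def restrictIncidence (X : Set (Vertex P)) (ε : P → P → ℤ) :
    InducedSubcomplex X → InducedSubcomplex X → ℤ :=
  fun x y => ε x.1 y.1

theorem IsIncidenceFunction.restrict {ε : P → P → ℤ} (hε : IsIncidenceFunction ε) :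
    IsIncidenceFunction (restrictIncidence X ε) where
  values x y := hε.values x.1 y.1
  ne_zero_iff x y := (hε.ne_zero_iff x.1 y.1).trans InducedSubcomplex.covBy_val_iff
  vertex v := hε.vertex ⟨v.1.1, InducedSubcomplex.isAtom_val v.2⟩
  cancel x z := by
    rw [← hε.cancel x.1 z.1]
    refine (finsum_mem_range (f := fun y => ε x.1 y * ε y z.1)
      (g := fun y : InducedSubcomplex X => y.1) Subtype.val_injective).symm.trans ?_
    rw [finsum_mem_def, Set.indicator_eq_self.2]
    intro y hy
    exact ⟨x.ofLE y (hε.le_of_ne_zero (left_ne_zero_of_mul hy)), rfl⟩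

theorem multidegree_restrictLabel {σ : Type u} [Finite P] (label : Vertex P → σ →₀ ℕ)
    (x : InducedSubcomplex X) :
    multidegree (restrictLabel (X := X) label) x = multidegree label x.1 := by
  refine le_antisymm (multidegree_le _ fun v hv => label_le_multidegree label hv)
    (multidegree_le label fun v hv => ?_)
  have hatom : IsAtom (x.ofLE v.1 hv) :=
    ⟨fun h => v.2.1 (congrArg Subtype.val h), fun y hy => Subtype.ext (v.2.2 y.1 hy)⟩
  exact label_le_multidegree (restrictLabel (X := X) label) (v := ⟨_, hatom⟩) (x := x) hv

/-- A cell of the induced subcomplex as a cell of the whole complex. -/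
def InducedSubcomplex.cell {i : ℕ} (x : Cell (InducedSubcomplex X) i) : Cell P i :=
  ⟨x.1.1, (InducedSubcomplex.height_val x.1).trans x.2⟩

theorem InducedSubcomplex.mem_range_cell_iff {i : ℕ} (x : Cell P i) :
    x ∈ Set.range (InducedSubcomplex.cell (X := X)) ↔ ∀ v : Vertex P, v.1 ≤ x.1 → v ∈ X := by
  constructor
  · rintro ⟨x, rfl⟩
    exact x.1.2
  · intro h
    exact ⟨⟨⟨x.1, h⟩, (InducedSubcomplex.height_val _).symm.trans x.2⟩, rfl⟩

/-- The cellular complex of an induced subcomplex is a subcomplex of the whole cellular complex. -/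
def cellularInclusion {σ : Type u} [Finite P] (k : Type v) [CommRing k]
    (label : Vertex P → σ →₀ ℕ) {ε : P → P → ℤ} (hε : IsIncidenceFunction ε) :
    (cellularComplex k (restrictLabel (X := X) label) (restrictIncidence X ε)).BasisInclusion
      (cellularComplex k label ε) where
  toFun i := InducedSubcomplex.cell
  injective i x y h := Subtype.ext (Subtype.ext (congrArg (fun z => z.1) h))
  deg_eq i x := congrArg Finsupp.degree (multidegree_restrictLabel label x.1).symm
  aug_eq x := congrArg (fun s => MvPolynomial.monomial s (1 : k))
    (multidegree_restrictLabel label x.1).symm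
  d_eq i x := by
    refine Finsupp.ext fun y => ?_
    by_cases hy : y ∈ Set.range (InducedSubcomplex.cell (X := X))
    · obtain ⟨y, rfl⟩ := hy
      refine Eq.trans ?_ (Finsupp.mapDomain_apply (fun a b h => Subtype.ext (Subtype.ext
        (congrArg (fun z => z.1) h))) _ y).symm
      change MvPolynomial.monomial (multidegree label x.1.1 - multidegree label y.1.1) _ =
        MvPolynomial.monomial (multidegree (restrictLabel label) x.1 -
          multidegree (restrictLabel label) y.1) _
      rw [multidegree_restrictLabel, multidegree_restrictLabel]
      rfl
    · refine Eq.trans ?_ (Finsupp.mapDomain_of_notMem_range _ y hy).symm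
      have h0 : ε x.1.1 y.1 = 0 := by
        by_contra h
        exact hy ((InducedSubcomplex.mem_range_cell_iff y).2 fun v hv =>
          x.1.2 v (hv.trans (hε.le_of_ne_zero h)))
      change MvPolynomial.monomial _ ((ε x.1.1 y.1 : ℤ) : k) = 0
      rw [h0, Int.cast_zero, map_zero]

end Induced

/-! ### Monomial ideals -/

section MonomialIdeals

variable {σ : Type u} {k : Type v} [Field k]

theorem IsMonomialIdeal.mem_iff {J : Ideal (MvPolynomial σ k)} (hJ : IsMonomialIdeal J)
    {p : MvPolynomial σ k} :
    p ∈ J ↔ ∀ s, p.coeff s ≠ 0 → MvPolynomial.monomial s (1 : k) ∈ J := by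
  classical
  obtain ⟨S, rfl⟩ := hJ
  simp only [MvPolynomial.mem_ideal_span_monomial_image, MvPolynomial.mem_support_iff,
    MvPolynomial.coeff_monomial]
  constructor
  · intro h s hs t ht
    split_ifs at ht with hst
    · exact hst ▸ h s hs
    · exact absurd rfl ht
  · exact fun h s hs => h s hs s (by simp)

theorem IsMonomialIdeal.entryComponent_mem {J : Ideal (MvPolynomial σ k)} (hJ : IsMonomialIdeal J)
    {p : MvPolynomial σ k} (hp : p ∈ J) (a b : ℕ) : entryComponent a b p ∈ J := by
  rw [hJ.mem_iff] at hp ⊢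
  intro s hs
  rw [coeff_entryComponent] at hs
  exact hp s fun h => hs (by rw [h, ite_self])

theorem monomial_mem_of_le {J : Ideal (MvPolynomial σ k)} {s t : σ →₀ ℕ}
    (hs : MvPolynomial.monomial s (1 : k) ∈ J) (hst : s ≤ t) :
    MvPolynomial.monomial t (1 : k) ∈ J := by
  rw [← tsub_add_cancel_of_le hst, ← one_mul (1 : k), ← MvPolynomial.monomial_mul]
  exact J.mul_mem_left _ hs

theorem exists_minimalGenerator_le [Finite σ] {J : Ideal (MvPolynomial σ k)} {t : σ →₀ ℕ}
    (ht : MvPolynomial.monomial t (1 : k) ∈ J) : ∃ s ∈ minimalGenerators J, s ≤ t := by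
  obtain ⟨s, hst, hs⟩ := exists_minimal_le_of_wellFoundedLT
    (fun t => MvPolynomial.monomial t (1 : k) ∈ J) t ht
  exact ⟨s, hs, hst⟩

theorem IsMonomialIdeal.le_of_minimalGenerators_subset [Finite σ] {I J : Ideal (MvPolynomial σ k)}
    (hJ : IsMonomialIdeal J) (h : minimalGenerators J ⊆ minimalGenerators I) : J ≤ I := by
  obtain ⟨S, hS⟩ := id hJ
  rw [hS, Ideal.span_le]
  rintro _ ⟨t, ht, rfl⟩
  have htJ : MvPolynomial.monomial t (1 : k) ∈ J := by
    rw [hS]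
    exact Ideal.subset_span ⟨t, ht, rfl⟩
  obtain ⟨s, hs, hst⟩ := exists_minimalGenerator_le htJ
  exact monomial_mem_of_le (h hs).1 hst

/-- The initial degree of a minimal graded free resolution of a monomial ideal is the least degree
of a monomial in the ideal. -/
theorem FreeSequence.IsMinimalFreeResolution.initialDegree_eq {F : FreeSequence.{u, v, w} σ k}
    {J : Ideal (MvPolynomial σ k)} (hF : F.IsMinimalFreeResolution J) (hJ : IsMonomialIdeal J)
    {s : σ →₀ ℕ} (hs : MvPolynomial.monomial s (1 : k) ∈ J)
    (hmin : ∀ t, MvPolynomial.monomial t (1 : k) ∈ J → s.degree ≤ t.degree) :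
    F.initialDegree = s.degree := by
  obtain ⟨g, hg, hgs⟩ := hF.exists_homogeneous_aug hs (e := s.degree)
    (isHomogeneousEntry_monomial fun _ => rfl)
  have hg0 : g ≠ 0 := by
    rintro rfl
    rw [map_zero, eq_comm, MvPolynomial.monomial_eq_zero] at hgs
    exact one_ne_zero hgs
  obtain ⟨b, hb⟩ := Finsupp.ne_iff.1 hg0
  have h1 : F.deg 0 b ≤ s.degree := le_of_not_gt fun h => hb ((hg b).eq_zero_of_lt h)
  have h2 := hF.le_deg 0 b
  obtain ⟨c, hc⟩ := Nat.sInf_mem (s := Set.range (F.deg 0)) ⟨_, b, rfl⟩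
  have hc0 : F.aug c ≠ 0 := by
    intro h
    refine hF.single_notMem_cycles 0 c ?_
    rw [FreeSequence.cycles, LinearMap.mem_ker, FreeSequence.augMap_single, h]
  obtain ⟨t, ht⟩ := MvPolynomial.ne_zero_iff.1 hc0
  have h3 := isHomogeneousEntry_iff.1 (hF.aug_homogeneous c) t ht
  have h4 := hmin t (hJ.mem_iff.1 (hF.aug_mem c) t ht)
  have h5 : F.deg 0 c = F.initialDegree := hc
  omega

end MonomialIdeals

/-! ### Restriction of the linear strand -/

section Restriction

variable {σ : Type u} {k : Type v} [Field k] {P : Type w} [PartialOrder P] [OrderBot P] [Finite P]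
  {label : Vertex P → σ →₀ ℕ} {ε : P → P → ℤ} {I J : Ideal (MvPolynomial σ k)} {d : ℕ}

/-- The multidegree of a vertex determines it, as the augmentation is injective in the lowest
degree. -/
theorem multidegree_cell_zero_injective (hC : (cellularComplex k label ε).IsLinearStrandOf I d)
    (x y : Cell P 0) (hxy : multidegree label x.1 = multidegree label y.1) : x = y := by
  classical
  by_contra hne
  let x' : (cellularComplex k label ε).B 0 := x
  let y' : (cellularComplex k label ε).B 0 := y
  have hne' : y' ≠ x' := fun h => hne h.symm
  have h := hC.aug_injective (Finsupp.single x' (MvPolynomial.C 1) -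
    Finsupp.single y' (MvPolynomial.C 1)) (.sub (.single _ (hC.deg_eq _ _) _)
      (.single _ (hC.deg_eq _ _) _)) (by
        rw [map_one, map_sub, FreeSequence.augMap_single, FreeSequence.augMap_single, sub_eq_zero]
        exact congrArg (fun s => MvPolynomial.monomial s (1 : k)) hxy)
  have := congrArg (fun p => p x') h
  simp [hne'] at this

/-- In the lowest degree, the coefficient of `m_x` in the augmentation of `f` is the coefficient of
`e_x` in `f`. -/
theorem coeff_augMap (hC : (cellularComplex k label ε).IsLinearStrandOf I d)
    {f : (cellularComplex k label ε).B 0 →₀ MvPolynomial σ k}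
    (hf : IsHomogeneousElement ((cellularComplex k label ε).deg 0) d f)
    (x : (cellularComplex k label ε).B 0) :
    MvPolynomial.coeff (multidegree label x.1) ((cellularComplex k label ε).augMap f) =
      MvPolynomial.constantCoeff (f x) := by
  classical
  have : Fintype ((cellularComplex k label ε).B 0) := Fintype.ofFinite (Cell P 0)
  rw [linearMap_apply_eq_sum _ f (t := Finset.univ) (Finset.subset_univ _),
    MvPolynomial.coeff_sum, Finset.sum_eq_single x]
  · rw [FreeSequence.augMap_single]
    change MvPolynomial.coeff _ (f x * MvPolynomial.monomial (multidegree label x.1) 1) = _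
    rw [MvPolynomial.coeff_mul_monomial', if_pos le_rfl]
    simp [MvPolynomial.constantCoeff_eq]
  · intro y _ hy
    have hfy := hf y
    rw [hC.deg_eq] at hfy
    rw [FreeSequence.augMap_single, hfy.eq_C]
    change MvPolynomial.coeff _ (MvPolynomial.C _ * MvPolynomial.monomial (multidegree label y.1) 1)
      = 0
    rw [MvPolynomial.C_mul_monomial, MvPolynomial.coeff_monomial, if_neg]
    exact fun h => hy (multidegree_cell_zero_injective hC y x h)
  · exact fun h => absurd (Finset.mem_univ x) h

/-- The differential of a linear combination `g` of cells has no cancellation: a facet `y` of `x`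
occurs in it if `x` occurs in `g`. -/
theorem dMap_apply_ne_zero (hC : (cellularComplex k label ε).IsLinearStrandOf I d)
    (hL : LinearLabelling (multidegree label) faceHeight ε d) {i : ℕ}
    {g : (cellularComplex k label ε).B (i + 1) →₀ MvPolynomial σ k}
    (hg : IsHomogeneousElement ((cellularComplex k label ε).deg (i + 1)) (d + (i + 1)) g)
    {x : (cellularComplex k label ε).B (i + 1)} {y : (cellularComplex k label ε).B i}
    (hyx : y.1 ⋖ x.1) (hx : g x ≠ 0) :
    (cellularComplex k label ε).dMap i g y ≠ 0 := by
  classical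
  have hgC : ∀ z, g z = MvPolynomial.C (MvPolynomial.constantCoeff (g z)) := by
    intro z
    have := hg z
    rw [hC.deg_eq] at this
    exact this.eq_C
  have hgx : MvPolynomial.constantCoeff (g x) ≠ 0 := by
    intro h
    exact hx (by rw [hgC x, h, map_zero])
  have hεk : ((ε x.1 y.1 : ℤ) : k) ≠ 0 := by
    have h0 := (hL.incidence.ne_zero_iff _ _).2 hyx
    rcases (hL.incidence.values x.1 y.1).resolve_left h0 with h | h <;> simp [h]
  intro h0
  have : Fintype ((cellularComplex k label ε).B (i + 1)) := Fintype.ofFinite (Cell P (i + 1))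
  have hsum := congrArg (MvPolynomial.coeff (multidegree label x.1 - multidegree label y.1)) h0
  rw [linearMap_apply_eq_sum _ g (t := Finset.univ)
    (Finset.subset_univ _), Finsupp.finsetSum_apply, MvPolynomial.coeff_sum,
    MvPolynomial.coeff_zero] at hsum
  have hterm : ∀ z : (cellularComplex k label ε).B (i + 1), MvPolynomial.coeff
      (multidegree label x.1 - multidegree label y.1)
      ((g z • (cellularComplex k label ε).dMap i (Finsupp.single z 1)) y) =
      if multidegree label z.1 - multidegree label y.1 =
          multidegree label x.1 - multidegree label y.1
      then MvPolynomial.constantCoeff (g z) * ((ε z.1 y.1 : ℤ) : k) else 0 := by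
    intro z
    rw [FreeSequence.dMap_single, hgC z]
    change MvPolynomial.coeff _ (MvPolynomial.C _ * MvPolynomial.monomial
      (multidegree label z.1 - multidegree label y.1) ((ε z.1 y.1 : ℤ) : k)) = _
    rw [MvPolynomial.C_mul_monomial, MvPolynomial.coeff_monomial, ← hgC z]
  rw [Finset.sum_congr rfl fun z _ => hterm z, Finset.sum_eq_single x, if_pos rfl] at hsum
  · exact mul_ne_zero hgx hεk hsum
  · intro z _ hz
    split_ifs with hm
    · have hε0 : ε z.1 y.1 = 0 := by
        by_contra hne
        have hyz := (hL.incidence.ne_zero_iff _ _).1 hne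
        have hm' : multidegree label z.1 = multidegree label x.1 := by
          rw [← tsub_add_cancel_of_le (hL.mono hyz.le), hm,
            tsub_add_cancel_of_le (hL.mono hyx.le)]
        have h1 := faceHeight_cell x
        have h2 := faceHeight_cell z
        exact hz (Subtype.ext (hL.eq_of_common_facet (by omega) (by omega) hyz hyx hm'))
      rw [hε0, Int.cast_zero, mul_zero]
    · rfl
  · exact fun h => absurd (Finset.mem_univ x) h

/-- A linear combination of cells whose boundary lies in an induced subcomplex lies there itself:
a face outside of an induced subcomplex has a facet outside of it. -/
theorem mem_range_cell_of_dMap (hC : (cellularComplex k label ε).IsLinearStrandOf I d)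
    (hL : LinearLabelling (multidegree label) faceHeight ε d) {X : Set (Vertex P)} {i : ℕ}
    {g : (cellularComplex k label ε).B (i + 1) →₀ MvPolynomial σ k}
    (hg : IsHomogeneousElement ((cellularComplex k label ε).deg (i + 1)) (d + (i + 1)) g)
    (h : ∀ y : Cell P i, (cellularComplex k label ε).dMap i g y ≠ 0 →
      y ∈ Set.range (InducedSubcomplex.cell (X := X))) (x : Cell P (i + 1)) (hx : g x ≠ 0) :
    x ∈ Set.range (InducedSubcomplex.cell (X := X)) := by
  rw [InducedSubcomplex.mem_range_cell_iff]
  intro v hv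
  have hvx : v.1 < x.1 := by
    refine hv.lt_of_ne fun h => ?_
    have h1 := faceHeight_cell x
    have h2 := hL.ht_eq_of_covBy (bot_covBy_iff.2 v.2)
    rw [hL.ht_bot, h, h1] at h2
    omega
  obtain ⟨y, hvy, hyx⟩ := exists_le_covBy_of_lt hvx
  have hy : faceHeight y = i + 1 := by
    have h1 := faceHeight_cell x
    have h2 := hL.ht_eq_of_covBy hyx
    omega
  exact (InducedSubcomplex.mem_range_cell_iff _).1
    (h (cellOfFaceHeight y hy) (dMap_apply_ne_zero hC hL hg hyx hx)) v hvy

/-- The cellular complex of the subcomplex induced on the generators of `J` is the linear strand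
of `J`. -/
theorem isLinearStrandOf_restrict (hC : (cellularComplex k label ε).IsLinearStrandOf I d)
    (hL : LinearLabelling (multidegree label) faceHeight ε d) (hJ : IsMonomialIdeal J)
    (hJI : J ≤ I) (hlow : ∀ t, MvPolynomial.monomial t (1 : k) ∈ J → d ≤ t.degree) :
    (cellularComplex k (restrictLabel (X := generatorVertices label J) label)
      (restrictIncidence (generatorVertices label J) ε)).IsLinearStrandOf J d := by
  classical
  let ι := cellularInclusion (X := generatorVertices label J) k label hL.incidence
  have haug : ∀ (x : Cell P 0) (v : Vertex P), v.1 ≤ x.1 → multidegree label x.1 = label v := by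
    intro x v hv
    rw [← multidegree_vertex label v, ((isAtom_cell x).le_iff_eq v.2.1).1 hv]
  refine ⟨fun i x => ?_, cellularComplex_aug_homogeneous _ _,
    cellularComplex_d_homogeneous _ hL.incidence.restrict,
    fun i x => ι.d_mem_cycles (hC.d_mem_cycles i _), fun x => ?_, fun p hp hpd => ?_,
    fun f hf h0 => ι.map_injective 0 ?_, fun i f hf hfd => ?_,
    fun i g hg h0 => ι.map_injective (i + 1) ?_⟩
  · rw [← ι.deg_eq]
    exact hC.deg_eq i _
  · let y : Cell P 0 := InducedSubcomplex.cell x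
    have hv : label ⟨y.1, isAtom_cell y⟩ ∈ minimalGenerators J := x.1.2 ⟨y.1, isAtom_cell y⟩ le_rfl
    rw [← ι.aug_eq]
    change MvPolynomial.monomial (multidegree label y.1) (1 : k) ∈ J
    rw [haug y ⟨y.1, isAtom_cell y⟩ le_rfl]
    exact hv.1
  · obtain ⟨f, hf, rfl⟩ := hC.aug_surjective p (hJI hp) hpd
    obtain ⟨f, rfl⟩ := ι.exists_map_eq 0 f fun x hx => by
      refine (InducedSubcomplex.mem_range_cell_iff (i := 0) x).2 fun v hv => ?_
      have hmem : MvPolynomial.monomial (label v) (1 : k) ∈ J := by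
        refine hJ.mem_iff.1 hp _ ?_
        rw [← haug x v hv, coeff_augMap hC hf x]
        intro h0
        have hfx := hf x
        rw [hC.deg_eq] at hfx
        exact hx (by rw [hfx.eq_C, h0, map_zero])
      refine ⟨hmem, fun t ht htv => ?_⟩
      -- A proper divisor of `m_v` has smaller degree than allowed in `J`.
      have hdeg : (label v).degree = d := by
        rw [← haug x v hv]
        exact hC.deg_eq 0 x
      obtain ⟨r, hr⟩ := exists_add_of_le htv
      have h1 := hlow t ht
      have h2 := congrArg Finsupp.degree hr
      rw [map_add] at h2
      have h3 : r = 0 := (Finsupp.degree_eq_zero_iff r).1 (by omega)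
      rw [hr, h3, add_zero]
    exact ⟨f, (ι.isHomogeneousElement_iff 0 d f).1 hf, (ι.augMap_map f).symm⟩
  · rw [map_zero]
    exact hC.aug_injective _ ((ι.isHomogeneousElement_iff _ _ _).2 hf) (by rw [ι.augMap_map, h0])
  · obtain ⟨g, hg, hgf⟩ := hC.d_surjective i _ ((ι.mem_cycles_iff i f).2 hf)
      ((ι.isHomogeneousElement_iff _ _ _).2 hfd)
    obtain ⟨g, rfl⟩ := ι.exists_map_eq (i + 1) g (mem_range_cell_of_dMap hC hL hg fun y hy => by
      by_contra hny
      exact hy (by rw [hgf]; exact ι.map_apply_of_notMem i f y hny))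
    rw [ι.dMap_map] at hgf
    exact ⟨g, (ι.isHomogeneousElement_iff _ _ _).1 hg, ι.map_injective i hgf⟩
  · rw [map_zero]
    exact hC.d_injective i _ ((ι.isHomogeneousElement_iff _ _ _).2 hg)
      (by rw [ι.dMap_map, h0, map_zero])

end Restriction

end

theorem mainTheorem4 {σ : Type u} [Finite σ] {k : Type v} [Field k]
    {P : Type w} [PartialOrder P] [OrderBot P] [Finite P] (hP : IsCWPoset P)
    (label : Vertex P → σ →₀ ℕ)
    (I : Ideal (MvPolynomial σ k)) (hI : IsMonomialIdeal I)
    (hsupp : SupportsLinearStrand label I)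
    (hedge : ∀ x y : Cell P 1, multidegree label x.1 = multidegree label y.1 → x = y)
    (J : Ideal (MvPolynomial σ k)) (hJ : IsMonomialIdeal J)
    (hJI : minimalGenerators J ⊆ minimalGenerators I)
    (hdeg : ∃ s ∈ minimalGenerators J, ∀ t ∈ minimalGenerators I, s.degree ≤ t.degree) :
    IsCWPoset (InducedSubcomplex (generatorVertices label J)) ∧
      SupportsLinearStrand (restrictLabel (X := generatorVertices label J) label) J ∧
      (HasLinearResolution J →
        SupportsMinimalResolution (restrictLabel (X := generatorVertices label J) label) J) := by
  obtain ⟨ε, hε, F, hF, ⟨φ⟩⟩ := hsupp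
  obtain ⟨s, hs, hmin⟩ := hdeg
  have hle := hJ.le_of_minimalGenerators_subset hJI
  have hlowI : ∀ t, MvPolynomial.monomial t (1 : k) ∈ I → s.degree ≤ t.degree := by
    intro t ht
    obtain ⟨r, hr, hrt⟩ := exists_minimalGenerator_le ht
    exact (hmin r hr).trans (Finsupp.degree_mono hrt)
  have hlowJ : ∀ t, MvPolynomial.monomial t (1 : k) ∈ J → s.degree ≤ t.degree :=
    fun t ht => hlowI t (hle ht)
  have hC : (cellularComplex k label ε).IsLinearStrandOf I s.degree := by
    rw [← hF.initialDegree_eq hI (hle hs.1) hlowI]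
    exact hF.isLinearStrandOf.of_gradedIso φ (cellularComplex_aug_homogeneous label ε)
      (cellularComplex_d_homogeneous label hε)
  have hL := linearLabelling_of_isLinearStrandOf hP hε hC hedge
  have hCJ := isLinearStrandOf_restrict hC hL hJ hle hlowJ
  refine ⟨hP.inducedSubcomplex ?_, ⟨_, hε.restrict, ?_⟩, fun hlin => ⟨_, hε.restrict, ?_⟩⟩
  · -- The monomial `s` is the augmentation of an element, so some vertex has a label in `J`.
    obtain ⟨f, -, hfs⟩ := hCJ.aug_surjective _ hs.1 (isHomogeneousEntry_monomial fun _ => rfl)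
    have hf0 : f ≠ 0 := by
      rintro rfl
      rw [map_zero, eq_comm, MvPolynomial.monomial_eq_zero] at hfs
      exact one_ne_zero hfs
    obtain ⟨x, -⟩ := Finsupp.ne_iff.1 hf0
    let y : Cell P 0 := InducedSubcomplex.cell x
    exact ⟨⟨y.1, isAtom_cell y⟩, x.1.2 ⟨y.1, isAtom_cell y⟩ le_rfl⟩
  · obtain ⟨G, hG⟩ := exists_isMinimalFreeResolution J fun p hp e => hJ.entryComponent_mem hp e 0
    have hGJ := hG.isLinearStrandOf
    rw [hG.initialDegree_eq hJ hs.1 hlowJ] at hGJ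
    exact ⟨G, hG, hCJ.nonempty_gradedIso hGJ⟩
  · obtain ⟨G, hG, hGlin⟩ := hlin
    have hGJ := hG.isLinearStrandOf_of_linear hGlin
    rw [hG.initialDegree_eq hJ hs.1 hlowJ] at hGJ
    obtain ⟨ψ⟩ := hCJ.nonempty_gradedIso hGJ
    exact hCJ.isMinimalFreeResolution (fun i => inferInstanceAs (Finite (Cell _ i))) ψ hG
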